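/- **Setting.** Let $0\neq|a|<M$, $r_+=M+\sqrt{M^2-a^2}$, $\Delta=r^2-2Mr+a^2$, and $'=\frac{d}{dr^*}=\frac{\Delta}{r^2+a^2}\frac{d}{dr}$. A triple $(\omega,m,\Lambda)\in\mathbb R\times\mathbb Z\times\mathbb R$ is *admissible* if $\Lambda\ge|m|(|m|+1)$ and $\Lambda\ge|am\omega|$; for such a triple put $$V_0(r)=\frac{4Mram\omega-a^2m^2+\Delta\Lambda}{(r^2+a^2)^2}.$$ For $\epsilon>0$ let $I_{\rm gensuper}=(-\epsilon,(2Mr_+)^{-1}+\epsilon)$ and $I_{\rm strictsuper}=(\epsilon/2,(2Mr_+)^{-1}-\epsilon/2)$. Let $I_{\rm nonsuper}\subset\mathbb R\setminus[0,(2Mr_+)^{-1}]$ be an open set with two connected components, without limit points at $0$ and $(2Mr_+)^{-1}$, and with $I_{\rm nonsuper}\cup I_{\rm gensuper}=\mathbb R$; i.e. $I_{\rm nonsuper}=(-\infty,-\delta_1)\cup((2Mr_+)^{-1}+\delta_2,\infty)$ with $0<\delta_1,\delta_2<\epsilon$. Let $g$ be the Kerr metric with parameters $a,M$, and let $T=\partial_t$,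 $\Omega_1=\partial_\phi$ in Boyer–Lindquist coordinates $(t,r,\theta,\phi)$. For positive parameters $\omega_{\rm high},\epsilon_{\rm width},\alpha$, let $\mathcal G_\natural$ be the set of admissible triples with $|\omega|\ge\omega_{\rm high}$, $\epsilon_{\rm width}\Lambda\le\omega^2\le\epsilon_{\rm width}^{-1}\Lambda$ and $m\omega\notin(0,\frac{am^2}{2Mr_+}+\alpha\Lambda]$. For $b_{\rm trap}>0$ let $\mathcal G_\natural(b_{\rm trap})$ be the set of those triples in $\mathcal G_\natural$ for which $V_0$ has an interior local maximum $r^0_{\max}\in(r_+,\infty)$ with $|V_0(r^0_{\max})-\omega^2|\le b_{\rm trap}\omega^2$. A *trapping degeneration function* is a function $\chi_\natural(r,\omega,m,\Lambda)\ge0$, defined for $r>r_+$ and admissible triples, such that $\chi_\natural\equiv1$ for triples outside $\mathcal G_\natural(b_{\rm trap})$, and for each triple in $\mathcal G_\natural(b_{\rm trap})$: $\chi_\natural$ is smooth in $r$; it vanishes at $r^0_{\max}$; $\chi_\natural''\ge\kappa$ wherever $\chi_\natural\le\frac12$, with a constant $\kappa>0$ independent of the triple; and $\{r>r_+:\chi_\natural\le\frac12\}$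 is an interval. **Proposition.** There are $r_0\in(r_+,2.01M]$ and $R_0\ge5M$, depending only on $a,M$, such that for every $R_{\rm pot}>R_0$, every sufficiently small $\epsilon>0$ (depending on $a,M,R_{\rm pot}$), every $I_{\rm nonsuper}$ as above and every $r_{\rm pot}\in(r_+,r_0)$ the following holds. There exist integers $N_s\ge2$ and $N\ge N_s+2$, nonempty connected open intervals $I_1,\dots,I_N$ with $\bigcup_{n=1}^NI_n=\mathbb R$, numbers $\alpha_n\in\mathbb R$, nondegenerate intervals $[r_{n,1},r_{n,2}]\subset(r_{\rm pot},R_{\rm pot})$, and $b_{\rm pot},b'_{\rm pot}>0$, with the properties below. The constants implicit in $\gtrsim$ are positive and independent of $r$, $n$ and $(\omega,m,\Lambda)$. 1. $0\in I_1$, $(2Mr_+)^{-1}\in I_2$, $I_3,\dots,I_{N_s}\subset I_{\rm strictsuper}$, $\bigcup_{n=1}^{N_s}I_n=I_{\rm gensuper}$, $\bigcup_{n=N_s+1}^{N}I_n=I_{\rm nonsuper}$; $I_{N-1}$ is unbounded below and $I_N$ is unbounded above. 2. For $n=1,\dots,N_s$ one has $\alpha_n=\frac a{2Mr_+}$, and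 for all admissible $(\omega,m\ne0,\Lambda)$ with $\omega/(am)\in I_n$: $$\{r>r_+:V_0-\omega^2<b_{\rm pot}\omega^2,\ V_0'>0\}\subset(r_+,r_{n,1}),\qquad \{r>r_+:V_0-\omega^2<b_{\rm pot}\omega^2,\ V_0'<0\}\subset(r_{n,2},\infty),$$ $$[r_{n,1},r_{n,2}]\subset\{r>r_+:V_0-\omega^2\ge b_{\rm pot}\omega^2\},$$ $$\{r_+<r<2R_{\rm pot}:|V_0-\omega^2|\le b_{\rm pot}\omega^2,\ |V_0'|\le b'_{\rm pot}\Delta r^{-2}\omega^2\}=\emptyset,$$ and $V_0'\gtrsim\Delta r^{-2}(\Lambda+\omega^2)$ in $(r_+,r_{\rm pot}]$. 3. For $n=2,\dots,N$ and all admissible $(\omega,m\neq0,\Lambda)$ with $\omega/(am)\in I_n$: $\omega^2+V_0\gtrsim\Delta\Lambda$ in $\{r_+\le r\le1.2R_{\rm pot}\}\cap\{V_0\ge\omega^2\}$. 4. $[r_{1,1},r_{1,2}]\subset(4M,6M)$, and for all admissible $(\omega,m\ne0,\Lambda)$ with $\omega/(am)\in I_1$: $V_0'\gtrsim\Delta r^{-2}(\Lambda+\omega^2)$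 in $(r_+,2.1M]$, $V_0\gtrsim r^{-2}(\Lambda+\omega^2)$ in $[2.01M,\infty)$, and $V_0>\frac12\omega^2$ in $[2.01M,1.2R_{\rm pot}]$. 5. For $n=N_s+1,\dots,N$ and all admissible $(\omega,m,\Lambda)$ such that either $m\ne0$ and $\omega/(am)\in I_n$, or $n=N-1$, $m=0$, $a\omega<0$, or $n=N$, $m=0$, $a\omega>0$: $$\{r>r_+:|V_0-\omega^2|<b_{\rm pot}\omega^2,\ V_0'>0\}\subset(r_+,r_{n,2}),\qquad \{r>r_+:|V_0-\omega^2|<b_{\rm pot}\omega^2,\ V_0'<0\}\subset(r_{n,1},\infty),$$ $$\{r_+<r<2R_{\rm pot}:|V_0-\omega^2|<b_{\rm pot}\omega^2,\ |V_0'|<b'_{\rm pot}\Delta r^{-2}\omega^2\}\subset(r_{n,1},r_{n,2}).$$ 6. For $n=N_s+1,\dots,N$ one has $0\le\alpha_n\frac{2Mr_+}a\le1$, and there is a constant $\beta<0$ with $g(T+\alpha_n\Omega_1,T+\alpha_n\Omega_1)\le\beta$ in $\{r_{n,1}<r<r_{n,2}\}$ for all these $n$. Moreover $\alpha_{N-1}=\alpha_N=0$.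 7. If $b_{\rm trap}>0$ is sufficiently small, then for all positive $\omega_{\rm high},\epsilon_{\rm width},\alpha,\kappa$ there is $c'>0$ such that every trapping degeneration function $\chi_\natural$ with these parameters satisfies: $\chi_\natural(r,\omega,m,\Lambda)=1$ for all $r>r_+$, all $n\le N_s$ and all triples as in 2; and $\chi_\natural(r,\omega,m,\Lambda)\ge c'$ for all $n=N_s+1,\dots,N$, all triples as in 5 and all $r\in(r_+,r_{n,1}]\cup[r_{n,2},\infty)$. -/

import Mathlib

open Set

noncomputable section

namespace Kerr

/-- The event horizon radius `r₊ = M + √(M² - a²)`. -/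
def rPlus (M a : ℝ) : ℝ := M + Real.sqrt (M ^ 2 - a ^ 2)

/-- `Δ = r² - 2Mr + a²`. -/
def Delta (M a r : ℝ) : ℝ := r ^ 2 - 2 * M * r + a ^ 2

/-- The superradiant threshold `(2 M r₊)⁻¹` for the ratio `ω / (a m)`. -/
def gammaPlus (M a : ℝ) : ℝ := (2 * M * rPlus M a)⁻¹

/-- The operator `d/dr* = Δ / (r² + a²) · d/dr`, on functions of `r`. -/
def rStarDeriv (M a : ℝ) (f : ℝ → ℝ) (r : ℝ) : ℝ :=
  Delta M a r / (r ^ 2 + a ^ 2) * deriv f r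

/-- Admissible frequency triples `(ω, m, Λ)`. -/
def Admissible (a ω : ℝ) (m : ℤ) (Λ : ℝ) : Prop :=
  |(m : ℝ)| * (|(m : ℝ)| + 1) ≤ Λ ∧ |a * m * ω| ≤ Λ

/-- The high frequency potential `V₀(ω, m, Λ, r)`. -/
def V0 (M a ω : ℝ) (m : ℤ) (Λ r : ℝ) : ℝ :=
  (4 * M * r * a * m * ω - a ^ 2 * (m : ℝ) ^ 2 + Delta M a r * Λ) / (r ^ 2 + a ^ 2) ^ 2

/-- `V₀' = dV₀/dr*`. -/
def V0' (M a ω : ℝ) (m : ℤ) (Λ r : ℝ) : ℝ :=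
  rStarDeriv M a (V0 M a ω m Λ) r

/-- `ρ² = r² + a² cos² θ`. -/
def rhoSq (a r θ : ℝ) : ℝ := r ^ 2 + a ^ 2 * Real.cos θ ^ 2

/-- The Kerr metric at a point with Boyer-Lindquist coordinates `(t, r, θ, φ)`, as a bilinear form
in the components of vectors with respect to `∂_t, ∂_r, ∂_θ, ∂_φ` (indices `0, 1, 2, 3`). -/
def metric (M a r θ : ℝ) (u v : Fin 4 → ℝ) : ℝ :=
  -(Delta M a r / rhoSq a r θ) *
      (u 0 - a * Real.sin θ ^ 2 * u 3) * (v 0 - a * Real.sin θ ^ 2 * v 3)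
    + rhoSq a r θ / Delta M a r * u 1 * v 1
    + rhoSq a r θ * u 2 * v 2
    + Real.sin θ ^ 2 / rhoSq a r θ *
      (a * u 0 - (r ^ 2 + a ^ 2) * u 3) * (a * v 0 - (r ^ 2 + a ^ 2) * v 3)

/-- The stationary Killing field `T = ∂_t`. -/
def T : Fin 4 → ℝ := Pi.single 0 1

/-- The axisymmetric Killing field `Ω₁ = ∂_φ`. -/
def Omega1 : Fin 4 → ℝ := Pi.single 3 1

/-- The range `𝒢_♮` of admissible triples, with its parameters `ω_high`, `ε_width`, `α`. -/
def NaturalRange (M a ωhigh εwidth α ω : ℝ) (m : ℤ) (Λ : ℝ) : Prop :=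
  Admissible a ω m Λ ∧ ωhigh ≤ |ω| ∧ εwidth * Λ ≤ ω ^ 2 ∧ ω ^ 2 ≤ εwidth⁻¹ * Λ ∧
    (m : ℝ) * ω ∉ Ioc 0 (a * (m : ℝ) ^ 2 / (2 * M * rPlus M a) + α * Λ)

/-- `r` is an interior local maximum point of `V₀` on `(r₊, ∞)`. -/
def IsInteriorMax (M a ω : ℝ) (m : ℤ) (Λ r : ℝ) : Prop :=
  rPlus M a < r ∧ IsLocalMax (V0 M a ω m Λ) r

/-- The range `𝒢_♮(b_trap)`: the triples of `𝒢_♮` for which `V₀` has an interior maximum, with value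
`V_max` satisfying `|V_max - ω²| ≤ b_trap ω²`. -/
def TrappedRange (M a ωhigh εwidth α btrap ω : ℝ) (m : ℤ) (Λ : ℝ) : Prop :=
  NaturalRange M a ωhigh εwidth α ω m Λ ∧
    ∃ r, IsInteriorMax M a ω m Λ r ∧ |V0 M a ω m Λ r - ω ^ 2| ≤ btrap * ω ^ 2

/-- `χ(r, ω, m, Λ)` is a trapping degeneration function `χ_♮` for the range `𝒢_♮(b_trap)`. The
constant `κ` is the one implicit in `χ'' ≳ 1`; it does not depend on the frequency triple. The last
field says that for each triple the function degenerates in one single well only. -/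
structure IsTrappingDegeneration (M a ωhigh εwidth α btrap κ : ℝ)
    (χ : ℝ → ℝ → ℤ → ℝ → ℝ) : Prop where
  nonneg : ∀ r ω m Λ, rPlus M a < r → Admissible a ω m Λ → 0 ≤ χ r ω m Λ
  eq_one : ∀ r ω m Λ, rPlus M a < r → Admissible a ω m Λ →
    ¬ TrappedRange M a ωhigh εwidth α btrap ω m Λ → χ r ω m Λ = 1
  smooth : ∀ ω m Λ, TrappedRange M a ωhigh εwidth α btrap ω m Λ →
    ContDiffOn ℝ (⊤ : ℕ∞) (fun r => χ r ω m Λ) (Ioi (rPlus M a))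
  vanish : ∀ r ω m Λ, TrappedRange M a ωhigh εwidth α btrap ω m Λ →
    IsInteriorMax M a ω m Λ r → χ r ω m Λ = 0
  convex : ∀ r ω m Λ, rPlus M a < r → TrappedRange M a ωhigh εwidth α btrap ω m Λ →
    χ r ω m Λ ≤ 1 / 2 → κ ≤ rStarDeriv M a (rStarDeriv M a (fun s => χ s ω m Λ)) r
  single_well : ∀ ω m Λ, TrappedRange M a ωhigh εwidth α btrap ω m Λ →
    OrdConnected {r | rPlus M a < r ∧ χ r ω m Λ ≤ 1 / 2}

/-- The generalised superradiant range `I_gensuper = (-ε, (2Mr₊)⁻¹ + ε)` of `ω / (a m)`. -/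
def genSuper (M a ε : ℝ) : Set ℝ := Ioo (-ε) (gammaPlus M a + ε)

/-- The range `I_strictsuper = (ε/2, (2Mr₊)⁻¹ - ε/2)`. -/
def strictSuper (M a ε : ℝ) : Set ℝ := Ioo (ε / 2) (gammaPlus M a - ε / 2)

/-- The non-superradiant range `I_nonsuper`. For `0 < δ₁, δ₂ < ε` these are exactly the open subsets
of `ℝ ∖ [0, (2Mr₊)⁻¹]` with two connected components which do not accumulate at `0` or `(2Mr₊)⁻¹`
and which together with `I_gensuper` cover `ℝ`. -/
def nonSuper (M a δ₁ δ₂ : ℝ) : Set ℝ := Iio (-δ₁) ∪ Ioi (gammaPlus M a + δ₂)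

/-- `(ω, m)` has `m ≠ 0` and `ω / (a m) ∈ I`. -/
def RatioIn (a : ℝ) (I : Set ℝ) (ω : ℝ) (m : ℤ) : Prop := m ≠ 0 ∧ ω / (a * m) ∈ I

/-- The frequency pairs attached to the `n`-th range, where `m = 0` is included in the range `N - 1`
if `a ω < 0` and in the range `N` if `a ω > 0`. -/
def InRange (a : ℝ) (I : ℕ → Set ℝ) (N n : ℕ) (ω : ℝ) (m : ℤ) : Prop :=
  RatioIn a (I n) ω m ∨ (n + 1 = N ∧ m = 0 ∧ a * ω < 0) ∨ (n = N ∧ m = 0 ∧ 0 < a * ω)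

end Kerr

end

noncomputable section

namespace Kerr

/-! Write `k = a m`, `A = r² + a²`, `γ = ω / k`, `t = k / ω`. The numerator `potSlope` of `dV₀/dr`
is a cubic polynomial in `r`, so three of its values satisfy an exact secant identity,
`potSlope_secant`. The error term there is nonnegative on `[r₊, ∞)` unless `kω` is very negative
compared with `Λ`, so `potSlope` lies above its chords from `r₊`.

Generalised superradiant ratios: `potSlope` is positive at the horizon (`exists_le_potSlope`), so by
this concavity `V₀` rises and then falls. Moreover `V₀ - ω² ≥ c₀ Λ` on a whole interval. It suffices
to find one good radius: the corotation radius `γ A = 1`, where the square in `pot_sub_sq` vanishes,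
or `5M` when `γ` is too small (`exists_superFun_pos`). Hence wherever `V₀ - ω²` is small, `r` lies
off that interval and the slope has a definite sign (`potSlope_dichotomy`). In particular no
critical point is trapped.

Non-superradiant ratios: `Delta_mul_potSlope` eliminates `Λ`. Where `V₀ ≈ ω²`, the slope has the
sign of `(A - t) * trapFun`, up to a small error. For `t < r₊² + a²`, `trapFun` is positive at the
horizon, and a zero `ρ` outside it separates positive from negative values, so near-trapping is
confined to a neighbourhood of `ρ`. The Killing field `T + a / (ρ² + a²) Ω₁` is timelike at `ρ`,
because the spacelike square in `timeFun` vanishes there. When `t` is small or negative, trapping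
stays beyond `2.05M`, where `T` itself is timelike. Just above the threshold, the horizon bound on
`potSlope` replaces the degenerating product.

All these conditions are open in `γ`. Compactness of the remaining ratio intervals then gives
finitely many ranges and uniform constants (`exists_list_cover`, `exists_ranges`). The bounds on `χ`
follow by integrating its convexity twice from its zero (`le_of_convex_well`). -/

variable {M a : ℝ}

/-! ### The potential and its slope with real parameters -/

/-- The potential `V₀`, with `a m` replaced by a real number `k`. -/
def pot (M a k ω Λ r : ℝ) : ℝ :=
  (4 * M * r * k * ω - k ^ 2 + Delta M a r * Λ) / (r ^ 2 + a ^ 2) ^ 2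

/-- The coefficient of `Λ` in the numerator of `dV₀/dr`. -/
def cubic (M a r : ℝ) : ℝ := -2 * r ^ 3 + 6 * M * r ^ 2 - 2 * a ^ 2 * r - 2 * M * a ^ 2

/-- The numerator of `dV₀/dr`, whose denominator is `(r² + a²)³`. -/
def potSlope (M a k ω Λ r : ℝ) : ℝ :=
  Λ * cubic M a r + k * ω * (4 * M * a ^ 2 - 12 * M * r ^ 2) + 4 * r * k ^ 2

/-- `dV₀/dr*`, with `a m` replaced by a real number `k`. -/
def pot' (M a k ω Λ r : ℝ) : ℝ := Delta M a r * potSlope M a k ω Λ r / (r ^ 2 + a ^ 2) ^ 4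

/-- For fixed `t = k / ω`, the zero of `trapFun` in `(r₊, ∞)` is the trapped radius. -/
def trapFun (M a t r : ℝ) : ℝ := cubic M a r - 2 * (r - M) * t

theorem V0_eq_pot (M a ω : ℝ) (m : ℤ) (Λ : ℝ) : V0 M a ω m Λ = pot M a (a * m) ω Λ := by
  funext r; unfold V0 pot; congr 1; ring

theorem denom_pos (ha : a ≠ 0) (r : ℝ) : 0 < r ^ 2 + a ^ 2 := by positivity

theorem hasDerivAt_pot (ha : a ≠ 0) (k ω Λ r : ℝ) :
    HasDerivAt (pot M a k ω Λ) (potSlope M a k ω Λ r / (r ^ 2 + a ^ 2) ^ 3) r := by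
  have hA := denom_pos ha r
  have h1 : HasDerivAt (fun r : ℝ => 4 * M * r * k * ω - k ^ 2 + Delta M a r * Λ)
      (4 * M * k * ω + (2 * r - 2 * M) * Λ) r := by
    have h := (((hasDerivAt_id' r).const_mul (4 * M)).mul_const k).mul_const ω
    have h2 := ((hasDerivAt_pow 2 r).sub ((hasDerivAt_id' r).const_mul (2 * M))).add_const (a ^ 2)
    exact ((h.sub_const (k ^ 2)).add (h2.mul_const Λ)).congr_deriv (by norm_num)
  have h2 : HasDerivAt (fun r : ℝ => (r ^ 2 + a ^ 2) ^ 2) (2 * (r ^ 2 + a ^ 2) * (2 * r)) r :=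
    (((hasDerivAt_pow 2 r).add_const (a ^ 2)).pow 2).congr_deriv (by norm_num)
  refine (h1.div h2 (by positivity)).congr_deriv ?_
  unfold potSlope cubic Delta
  field_simp
  ring

theorem V0'_eq_pot' (ha : a ≠ 0) (ω : ℝ) (m : ℤ) (Λ r : ℝ) :
    V0' M a ω m Λ r = pot' M a (a * m) ω Λ r := by
  have hA := denom_pos ha r
  unfold V0' rStarDeriv pot'
  rw [V0_eq_pot, (hasDerivAt_pot ha _ _ _ _).deriv]
  field_simp

theorem Admissible.sq_le {ω Λ : ℝ} {m : ℤ} (h : Admissible a ω m Λ) : (a * m) ^ 2 ≤ a ^ 2 * Λ := by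
  have h1 := h.1
  have h2 : (m : ℝ) ^ 2 ≤ Λ := by
    rw [← sq_abs]; nlinarith [abs_nonneg (m : ℝ)]
  rw [mul_pow]; gcongr

theorem Admissible.abs_le {ω Λ : ℝ} {m : ℤ} (h : Admissible a ω m Λ) : |a * m * ω| ≤ Λ := h.2

/-! ### The horizon -/

theorem mass_pos (haM : |a| < M) : 0 < M := (abs_nonneg a).trans_lt haM

theorem sq_lt_sq_mass (haM : |a| < M) : a ^ 2 < M ^ 2 := sq_lt_sq' (abs_lt.1 haM).1 (abs_lt.1 haM).2

theorem mass_lt_rPlus (haM : |a| < M) : M < rPlus M a := by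
  have h := sq_lt_sq_mass haM
  have : 0 < Real.sqrt (M ^ 2 - a ^ 2) := Real.sqrt_pos.2 (by linarith)
  unfold rPlus; linarith

theorem rPlus_sq (haM : |a| < M) : rPlus M a ^ 2 = 2 * M * rPlus M a - a ^ 2 := by
  have h := sq_lt_sq_mass haM
  have : Real.sqrt (M ^ 2 - a ^ 2) ^ 2 = M ^ 2 - a ^ 2 := Real.sq_sqrt (by linarith)
  unfold rPlus; nlinarith

theorem rPlus_lt (ha : a ≠ 0) (haM : |a| < M) : rPlus M a < 2 * M := by
  have h1 := rPlus_sq haM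
  have h2 := mass_lt_rPlus haM
  have h3 := mass_pos haM
  have : 0 < a ^ 2 := by positivity
  nlinarith

theorem rPlus_pos (haM : |a| < M) : 0 < rPlus M a := (mass_pos haM).trans (mass_lt_rPlus haM)

theorem Delta_pos (haM : |a| < M) {r : ℝ} (hr : rPlus M a < r) : 0 < Delta M a r := by
  have h1 := rPlus_sq haM
  have h2 := mass_lt_rPlus haM
  unfold Delta; nlinarith

theorem Delta_nonneg (haM : |a| < M) {r : ℝ} (hr : rPlus M a ≤ r) : 0 ≤ Delta M a r := by
  have h1 := rPlus_sq haM
  have h2 := mass_lt_rPlus haM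
  unfold Delta; nlinarith

theorem gammaPlus_pos (haM : |a| < M) : 0 < gammaPlus M a := by
  have := rPlus_pos haM
  have := mass_pos haM
  unfold gammaPlus; positivity

theorem inv_gammaPlus (haM : |a| < M) : (gammaPlus M a)⁻¹ = rPlus M a ^ 2 + a ^ 2 := by
  rw [gammaPlus, inv_inv, rPlus_sq haM]; ring

theorem gammaPlus_mul (haM : |a| < M) : gammaPlus M a * (rPlus M a ^ 2 + a ^ 2) = 1 := by
  rw [← inv_gammaPlus haM, mul_inv_cancel₀ (gammaPlus_pos haM).ne']

/-- Follows from `a² < M² < r₊²`. This is what leaves a positive multiple of `Δ` in `V₀ - ω²` at the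
corotation radius. -/
theorem two_mul_gammaPlus_lt (haM : |a| < M) : 2 * a ^ 2 * gammaPlus M a < 1 := by
  have h1 := gammaPlus_mul haM
  have h2 := gammaPlus_pos haM
  have h3 := mass_lt_rPlus haM
  have h4 := sq_lt_sq_mass haM
  have h5 := mass_pos haM
  have : 2 * a ^ 2 < rPlus M a ^ 2 + a ^ 2 := by nlinarith
  nlinarith

theorem cubic_rPlus (haM : |a| < M) :
    cubic M a (rPlus M a) = 4 * M * rPlus M a * (rPlus M a - M) := by
  have h1 := rPlus_sq haM
  unfold cubic
  linear_combination (-2 * rPlus M a - 2 * M) * h1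

/-! ### Algebra of the potential -/

/-- The right side is affine in `k² ∈ [0, a² Λ]`, so only the two endpoints need checking. This
reduces uniformity in `(k, Λ)` to two inequalities in `γ` and `r`. -/
theorem le_of_sq_le {k Λ X Y c : ℝ} (hk : k ^ 2 ≤ a ^ 2 * Λ) (ha : a ≠ 0) (hY : c ≤ Y)
    (hX : c ≤ a ^ 2 * X + Y) : c * Λ ≤ X * k ^ 2 + Y * Λ := by
  have h0 : 0 < a ^ 2 := by positivity
  have h1 : 0 ≤ (Y - c) * (a ^ 2 * Λ - k ^ 2) := mul_nonneg (by linarith) (by linarith)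
  have h2 : 0 ≤ (a ^ 2 * X + Y - c) * k ^ 2 := mul_nonneg (by linarith) (by positivity)
  have : 0 ≤ a ^ 2 * (X * k ^ 2 + Y * Λ - c * Λ) := by nlinarith
  have := nonneg_of_mul_nonneg_right this h0
  linarith

theorem pot_sub_sq (ha : a ≠ 0) (k ω Λ r : ℝ) :
    (r ^ 2 + a ^ 2) ^ 2 * (pot M a k ω Λ r - ω ^ 2) =
      -(ω * (r ^ 2 + a ^ 2) - k) ^ 2 + Delta M a r * (Λ - 2 * k * ω) := by
  have hA := denom_pos ha r
  unfold pot Delta; field_simp; ring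

/-- `Λ` enters only through `V₀ - ω²`. At `V₀ = ω²` the sign of the slope is therefore decided by `k
/ ω` and `r` alone. -/
theorem Delta_mul_potSlope (ha : a ≠ 0) (k ω Λ r : ℝ) :
    Delta M a r * potSlope M a k ω Λ r =
      (r ^ 2 + a ^ 2) * (ω * (r ^ 2 + a ^ 2) - k) * (ω * cubic M a r - 2 * (r - M) * k)
        + cubic M a r * ((r ^ 2 + a ^ 2) ^ 2 * (pot M a k ω Λ r - ω ^ 2)) := by
  rw [pot_sub_sq ha]; unfold potSlope cubic Delta; ring

/-- The last factor comes from the second divided difference of a cubic, which is affine in `u + v +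
w`. Its sign gives concavity without any second derivative. -/
theorem potSlope_secant (k ω Λ u v w : ℝ) :
    potSlope M a k ω Λ v * (w - u) = potSlope M a k ω Λ u * (w - v) + potSlope M a k ω Λ w * (v - u)
      + (w - u) * (w - v) * (v - u) * (2 * Λ * (u + v + w - 3 * M) + 12 * M * (k * ω)) := by
  unfold potSlope cubic; ring

theorem trapFun_secant (t u v w : ℝ) :
    trapFun M a t v * (w - u) = trapFun M a t u * (w - v) + trapFun M a t w * (v - u)
      + (w - u) * (w - v) * (v - u) * (2 * (u + v + w - 3 * M)) := by
  unfold trapFun cubic; ring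

theorem trapFun_zero (r : ℝ) : trapFun M a 0 r = cubic M a r := by simp [trapFun]

/-! ### Uniform lower bounds by compactness -/

theorem continuous_tube {F : ℝ → ℝ → ℝ} (hF : Continuous (Function.uncurry F)) {K : Set ℝ}
    (hK : IsCompact K) {x₀ : ℝ} (h : ∀ r ∈ K, 0 < F x₀ r) :
    ∃ c > 0, ∀ᶠ x in nhds x₀, ∀ r ∈ K, c ≤ F x r := by
  have hc : Continuous (F x₀) := hF.comp (by fun_prop : Continuous fun r : ℝ => (x₀, r))
  obtain ⟨c, hc0, hcK⟩ : ∃ c > 0, ∀ r ∈ K, c < F x₀ r := by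
    rcases K.eq_empty_or_nonempty with rfl | hne
    · exact ⟨1, one_pos, by simp⟩
    · obtain ⟨r, hr, hmin⟩ := hK.exists_isMinOn hne hc.continuousOn
      exact ⟨F x₀ r / 2, half_pos (h r hr), fun s hs => (half_lt_self (h r hr)).trans_le (hmin hs)⟩
  refine ⟨c, hc0, hK.eventually_forall_of_forall_eventually fun r hr => ?_⟩
  have : ∀ᶠ p in nhds (x₀, r), c < Function.uncurry F p :=
    hF.continuousAt.eventually (lt_mem_nhds (hcK r hr))
  exact this.mono fun p hp => hp.le

theorem exists_pos_le {K : Set ℝ} (hK : IsCompact K) {f : ℝ → ℝ} (hf : ContinuousOn f K)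
    (h : ∀ r ∈ K, 0 < f r) : ∃ c > 0, ∀ r ∈ K, c ≤ f r := by
  rcases K.eq_empty_or_nonempty with rfl | hne
  · exact ⟨1, one_pos, by simp⟩
  · obtain ⟨r, hr, hmin⟩ := hK.exists_isMinOn hne hf
    exact ⟨f r, h r hr, fun s hs => hmin hs⟩

/-! ### The generalised superradiant range -/

theorem continuous_tube_Icc {F : ℝ → ℝ → ℝ} (hF : Continuous (Function.uncurry F)) {x₀ ρ l u : ℝ}
    (hρ : ρ ∈ Ioo l u) (h : 0 < F x₀ ρ) :
    ∃ r₁ r₂, l < r₁ ∧ r₁ < ρ ∧ ρ < r₂ ∧ r₂ < u ∧ ∃ c > 0, ∀ᶠ x in nhds x₀, ∀ r ∈ Icc r₁ r₂, c ≤ F x r := by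
  have hc : Continuous (F x₀) := hF.comp (by fun_prop : Continuous fun r : ℝ => (x₀, r))
  have h1 : ∀ᶠ r in nhds ρ, 0 < F x₀ r ∧ r ∈ Ioo l u :=
    (hc.continuousAt.eventually (lt_mem_nhds h)).and (Ioo_mem_nhds hρ.1 hρ.2)
  obtain ⟨δ, hδ, hb⟩ := Metric.eventually_nhds_iff.1 h1
  have hb' : ∀ r ∈ Icc (ρ - δ / 2) (ρ + δ / 2), 0 < F x₀ r ∧ r ∈ Ioo l u := fun r hr => by
    apply hb
    rw [Real.dist_eq, abs_lt]
    constructor <;> linarith [hr.1, hr.2]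
  refine ⟨ρ - δ / 2, ρ + δ / 2, (hb' _ ⟨le_rfl, by linarith⟩).2.1, by linarith, by linarith,
    (hb' _ ⟨by linarith, le_rfl⟩).2.2, ?_⟩
  exact continuous_tube hF isCompact_Icc fun r hr => (hb' r hr).1

theorem le_potSlope {k Λ c γ r : ℝ} (ha : a ≠ 0) (hk : k ^ 2 ≤ a ^ 2 * Λ) (h1 : c ≤ cubic M a r)
    (h2 : c ≤ a ^ 2 * (γ * (4 * M * a ^ 2 - 12 * M * r ^ 2) + 4 * r) + cubic M a r) :
    c * Λ ≤ potSlope M a k (γ * k) Λ r := by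
  have := le_of_sq_le hk ha h1 h2
  unfold potSlope; linarith

/-- At the threshold and at `r₊` both endpoint values of `le_of_sq_le` are positive; the second
equals `4 (r₊ - M) (M r₊ - a²)`. Continuity extends this to slightly larger `γ` and `r`. Smaller
`γ`, including all negative ones, only help because the coefficient `4 M a² - 12 M r²` is
nonpositive. -/
theorem exists_le_potSlope (ha : a ≠ 0) (haM : |a| < M) :
    ∃ ρ > rPlus M a, ∃ ε > 0, ∃ c > 0, ∀ γ ≤ gammaPlus M a + ε, ∀ r ∈ Icc (rPlus M a) ρ,
      ∀ k Λ, k ^ 2 ≤ a ^ 2 * Λ → c * Λ ≤ potSlope M a k (γ * k) Λ r := by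
  set F : ℝ → ℝ → ℝ := fun γ r => min (cubic M a r)
    (a ^ 2 * (γ * (4 * M * a ^ 2 - 12 * M * r ^ 2) + 4 * r) + cubic M a r) with hFdef
  have hF : Continuous (Function.uncurry F) := by
    simp only [hFdef, Function.uncurry_def, cubic]; fun_prop
  have hM := mass_pos haM
  have hr := mass_lt_rPlus haM
  have hsq := rPlus_sq haM
  have haM2 := sq_lt_sq_mass haM
  have hγ := gammaPlus_mul haM
  have h0 : 0 < F (gammaPlus M a) (rPlus M a) := by
    simp only [hFdef, lt_min_iff, cubic_rPlus haM]
    refine ⟨by nlinarith [mul_pos (mul_pos hM (rPlus_pos haM)) (sub_pos.2 hr)], ?_⟩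
    have h1 : gammaPlus M a * (2 * M * rPlus M a) = 1 := by rw [← hγ, hsq]; ring
    have h2 : gammaPlus M a * (12 * M * rPlus M a ^ 2) = 6 * rPlus M a := by
      linear_combination 6 * rPlus M a * h1
    have h3 : gammaPlus M a * (4 * M * a ^ 2) = 4 * M - 2 * rPlus M a := by
      have : a ^ 2 = 2 * M * rPlus M a - rPlus M a ^ 2 := by linarith
      rw [this]
      linear_combination (4 * M - 2 * rPlus M a) * h1
    have : a ^ 2 * (gammaPlus M a * (4 * M * a ^ 2 - 12 * M * rPlus M a ^ 2) + 4 * rPlus M a)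
        + 4 * M * rPlus M a * (rPlus M a - M) = 4 * (rPlus M a - M) * (M * rPlus M a - a ^ 2) := by
      rw [mul_sub, h2, h3]; ring
    rw [this]
    have : 0 < M * rPlus M a - a ^ 2 := by nlinarith
    have : 0 < rPlus M a - M := by linarith
    positivity
  obtain ⟨r₁, r₂, -, hr1, hr2, -, c, hc, hev⟩ := continuous_tube_Icc hF
    (show rPlus M a ∈ Ioo (rPlus M a - 1) (rPlus M a + 1) by constructor <;> linarith) h0
  obtain ⟨δ, hδ, hb⟩ := Metric.eventually_nhds_iff.1 hev
  refine ⟨r₂, hr2, δ / 2, half_pos hδ, c, hc, fun γ hγ r hr k Λ hk => ?_⟩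
  have h := hb (y := gammaPlus M a + δ / 2)
    (by rw [Real.dist_eq, add_sub_cancel_left, abs_of_pos (by linarith)]; linarith) r
    ⟨hr1.le.trans hr.1, hr.2⟩
  have h1 : c ≤ cubic M a r := h.trans (min_le_left _ _)
  have h2 := h.trans (min_le_right _ _)
  refine le_potSlope ha hk h1 (h2.trans ?_)
  have h3 : 4 * M * a ^ 2 - 12 * M * r ^ 2 ≤ 0 := by
    have : a ^ 2 ≤ r ^ 2 := by nlinarith [hr.1]
    nlinarith
  have h4 : (gammaPlus M a + δ / 2) * (4 * M * a ^ 2 - 12 * M * r ^ 2)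
      ≤ γ * (4 * M * a ^ 2 - 12 * M * r ^ 2) := mul_le_mul_of_nonpos_right hγ h3
  gcongr

theorem exists_weighted_le (haM : |a| < M) {c C ρ : ℝ} (hc : 0 < c) (hC : 0 ≤ C) :
    ∃ c₂ > 0, ∀ Λ ω r s : ℝ, 0 ≤ Λ → ω ^ 2 ≤ C * Λ → rPlus M a < r → r ≤ ρ → c * Λ ≤ s →
      c₂ * (Delta M a r * (r ^ 2)⁻¹ * (Λ + ω ^ 2)) ≤ Delta M a r * s / (r ^ 2 + a ^ 2) ^ 4 := by
  have hp := rPlus_pos haM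
  have hρ : 0 < (rPlus M a ^ 2 + ρ ^ 2 + a ^ 2) ^ 4 := by positivity
  refine ⟨c * rPlus M a ^ 2 / ((1 + C) * (rPlus M a ^ 2 + ρ ^ 2 + a ^ 2) ^ 4), by positivity,
    fun Λ ω r s hΛ hω hr hrρ hs => ?_⟩
  have hr0 : 0 < r := hp.trans hr
  have hD := Delta_pos haM hr
  have hA : 0 < (r ^ 2 + a ^ 2) ^ 4 := by positivity
  have h1 : (r ^ 2 + a ^ 2) ^ 4 ≤ (rPlus M a ^ 2 + ρ ^ 2 + a ^ 2) ^ 4 := by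
    apply pow_le_pow_left₀ (by positivity)
    nlinarith [sq_nonneg (rPlus M a)]
  have h2 : rPlus M a ^ 2 * (r ^ 2)⁻¹ ≤ 1 := by
    rw [← div_eq_mul_inv, div_le_one (by positivity)]; nlinarith
  have h3 : (Λ + ω ^ 2) / (1 + C) ≤ Λ := by
    rw [div_le_iff₀ (by positivity)]; nlinarith
  calc c * rPlus M a ^ 2 / ((1 + C) * (rPlus M a ^ 2 + ρ ^ 2 + a ^ 2) ^ 4)
        * (Delta M a r * (r ^ 2)⁻¹ * (Λ + ω ^ 2))
      = Delta M a r * (c * ((rPlus M a ^ 2 * (r ^ 2)⁻¹) * ((Λ + ω ^ 2) / (1 + C))))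
          / (rPlus M a ^ 2 + ρ ^ 2 + a ^ 2) ^ 4 := by field_simp
    _ ≤ Delta M a r * (c * (1 * Λ)) / (rPlus M a ^ 2 + ρ ^ 2 + a ^ 2) ^ 4 := by gcongr
    _ ≤ Delta M a r * s / (rPlus M a ^ 2 + ρ ^ 2 + a ^ 2) ^ 4 := by rw [one_mul]; gcongr
    _ ≤ Delta M a r * s / (r ^ 2 + a ^ 2) ^ 4 := by
        have : 0 ≤ s := le_trans (by positivity) hs
        gcongr

theorem exists_potSlope_eq (ha : a ≠ 0) (k ω Λ : ℝ) {u v : ℝ} (huv : u < v) :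
    ∃ s ∈ Ioo u v, potSlope M a k ω Λ s * (v - u) =
      (pot M a k ω Λ v - pot M a k ω Λ u) * (s ^ 2 + a ^ 2) ^ 3 := by
  obtain ⟨s, hs, h⟩ := exists_hasDerivAt_eq_slope (pot M a k ω Λ)
    (fun r => potSlope M a k ω Λ r / (r ^ 2 + a ^ 2) ^ 3) huv
    (fun r _ => (hasDerivAt_pot ha k ω Λ r).continuousAt.continuousWithinAt)
    (fun r _ => hasDerivAt_pot ha k ω Λ r)
  have hA := denom_pos ha s
  have : 0 < v - u := sub_pos.2 huv
  refine ⟨s, hs, ?_⟩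
  field_simp at h
  linarith

theorem pot'_pos_iff (ha : a ≠ 0) (haM : |a| < M) {k ω Λ r : ℝ} (hr : rPlus M a < r) :
    0 < pot' M a k ω Λ r ↔ 0 < potSlope M a k ω Λ r := by
  have hD := Delta_pos haM hr
  have hA : 0 < (r ^ 2 + a ^ 2) ^ 4 := by have := denom_pos ha r; positivity
  rw [pot', div_pos_iff_of_pos_right hA, mul_pos_iff_of_pos_left hD]

theorem pot'_neg_iff (ha : a ≠ 0) (haM : |a| < M) {k ω Λ r : ℝ} (hr : rPlus M a < r) :
    pot' M a k ω Λ r < 0 ↔ potSlope M a k ω Λ r < 0 := by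
  have hD := Delta_pos haM hr
  have hA : 0 < (r ^ 2 + a ^ 2) ^ 4 := by have := denom_pos ha r; positivity
  rw [pot', div_neg_iff]
  constructor
  · rintro (⟨-, h⟩ | ⟨h, -⟩)
    · linarith
    · by_contra! h'
      have := mul_nonneg hD.le h'
      linarith
  · intro h
    exact Or.inr ⟨mul_neg_of_pos_of_neg hD h, hA⟩

/-- If `V₀` exceeds `ω²` by `c₀ Λ` on `[r₁, r₂]`, then outside this interval and where
`V₀ - ω²` is small, `V₀` increases to the left of it and decreases to the right of it. -/
theorem potSlope_dichotomy (ha : a ≠ 0) (haM : |a| < M) {c₁ c₀ R : ℝ} (hc₁ : 0 < c₁) (hc₀ : 0 < c₀)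
    (hR : 0 < R) : ∃ c₃ > 0, ∀ r₁ r₂ k ω Λ : ℝ, rPlus M a < r₁ → r₁ < r₂ → r₂ < R → 0 < Λ →
      0 ≤ Λ * (rPlus M a - M) + 2 * M * (k * ω) → c₁ * Λ ≤ potSlope M a k ω Λ (rPlus M a) →
      (∀ r ∈ Icc r₁ r₂, c₀ * Λ ≤ pot M a k ω Λ r - ω ^ 2) →
      ∀ r, rPlus M a < r → pot M a k ω Λ r - ω ^ 2 ≤ c₀ / 2 * Λ →
        (r < r₁ ∧ c₃ * Λ ≤ potSlope M a k ω Λ r) ∨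
        (r₂ < r ∧ potSlope M a k ω Λ r < 0 ∧ (r < 2 * R → potSlope M a k ω Λ r ≤ -(c₃ * Λ))) := by
  have ha2 : 0 < (a ^ 2) ^ 3 := by positivity
  -- The second entry comes from the mean value theorem: a change of `V₀` by `c₀ Λ / 2` over a
  -- length at most `2R`, with `(s² + a²)³ ≥ (a²)³`.
  refine ⟨min c₁ ((a ^ 2) ^ 3 * c₀ / (4 * R)), lt_min hc₁ (by positivity), ?_⟩
  set c₃ := min c₁ ((a ^ 2) ^ 3 * c₀ / (4 * R)) with hc₃
  intro r₁ r₂ k ω Λ hr₁ hr₁₂ hr₂ hΛ hconc hhor hI r hr hV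
  have hM := mass_pos haM
  have h31 : c₃ ≤ c₁ := min_le_left _ _
  have h32 : c₃ * (4 * R) ≤ (a ^ 2) ^ 3 * c₀ := by
    rw [← le_div_iff₀ (by positivity)]; exact min_le_right _ _
  have hc₃0 : 0 < c₃ := lt_min hc₁ (by positivity)
  have hhor' : c₃ * Λ ≤ potSlope M a k ω Λ (rPlus M a) :=
    (mul_le_mul_of_nonneg_right h31 hΛ.le).trans hhor
  -- Concavity with left endpoint `r₊`: there `u + v + w - 3M ≥ 3 (r₊ - M)`, so the error term is
  -- controlled by `hconc`.
  have hsec : ∀ v w, rPlus M a < v → v < w →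
      potSlope M a k ω Λ (rPlus M a) * (w - v) + potSlope M a k ω Λ w * (v - rPlus M a)
        ≤ potSlope M a k ω Λ v * (w - rPlus M a) := by
    intro v w hv hw
    rw [potSlope_secant k ω Λ (rPlus M a) v w]
    have h1 : 0 ≤ (w - rPlus M a) * (w - v) * (v - rPlus M a) :=
      mul_nonneg (mul_nonneg (by linarith) (by linarith)) (by linarith)
    have h2 : 0 ≤ 2 * Λ * (rPlus M a + v + w - 3 * M) + 12 * M * (k * ω) := by nlinarith
    have := mul_nonneg h1 h2
    linarith
  have hpow : ∀ s : ℝ, (a ^ 2) ^ 3 ≤ (s ^ 2 + a ^ 2) ^ 3 := fun s =>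
    pow_le_pow_left₀ (by positivity) (by nlinarith [sq_nonneg s]) 3
  have hΛc : 0 < c₀ * Λ := mul_pos hc₀ hΛ
  rcases lt_or_ge r r₁ with h | h
  · refine Or.inl ⟨h, ?_⟩
    obtain ⟨s, hs, hse⟩ := exists_potSlope_eq (M := M) ha k ω Λ h
    have h1 : c₀ / 2 * Λ ≤ pot M a k ω Λ r₁ - pot M a k ω Λ r := by
      linarith [hI r₁ ⟨le_rfl, hr₁₂.le⟩]
    have h2 : c₀ / 2 * Λ * (a ^ 2) ^ 3 ≤ potSlope M a k ω Λ s * (r₁ - r) := by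
      rw [hse]; exact mul_le_mul h1 (hpow s) ha2.le (by linarith)
    have hsp : 0 < potSlope M a k ω Λ s := by
      by_contra! hcon
      have := mul_nonpos_of_nonpos_of_nonneg hcon (sub_pos.2 h).le
      have : 0 < c₀ / 2 * Λ * (a ^ 2) ^ 3 := by positivity
      linarith
    have h3 : c₃ * Λ ≤ potSlope M a k ω Λ s := by
      have h4 : potSlope M a k ω Λ s * (r₁ - r) ≤ potSlope M a k ω Λ s * (2 * R) :=
        mul_le_mul_of_nonneg_left (by linarith [rPlus_pos haM]) hsp.le
      have h5 : c₃ * Λ * (2 * R) ≤ potSlope M a k ω Λ s * (2 * R) := by nlinarith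
      exact le_of_mul_le_mul_right h5 (by positivity)
    -- The slope is at least `c₃ Λ` at `r₊` and at `s`, hence also at `r` in between.
    have h6 := hsec r s hr hs.1
    have h7 := mul_le_mul_of_nonneg_right hhor' (sub_pos.2 hs.1).le
    have h8 := mul_le_mul_of_nonneg_right h3 (sub_pos.2 hr).le
    have h9 : c₃ * Λ * (s - rPlus M a) ≤ potSlope M a k ω Λ r * (s - rPlus M a) := by nlinarith
    exact le_of_mul_le_mul_right h9 (by linarith [hs.1])
  · have h' : r₂ < r := by
      by_contra! hcon
      linarith [hI r ⟨h, hcon⟩]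
    obtain ⟨s, hs, hse⟩ := exists_potSlope_eq (M := M) ha k ω Λ h'
    have hrs : rPlus M a < s := by linarith [hs.1]
    have h1 : c₀ / 2 * Λ ≤ pot M a k ω Λ r₂ - pot M a k ω Λ r := by
      linarith [hI r₂ ⟨hr₁₂.le, le_rfl⟩]
    have h2 : c₀ / 2 * Λ * (a ^ 2) ^ 3 ≤ -(potSlope M a k ω Λ s * (r - r₂)) := by
      rw [hse, ← neg_mul, neg_sub]; exact mul_le_mul h1 (hpow s) ha2.le (by linarith)
    have hsp : potSlope M a k ω Λ s < 0 := by
      by_contra! hcon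
      have := mul_nonneg hcon (sub_pos.2 h').le
      have : 0 < c₀ / 2 * Λ * (a ^ 2) ^ 3 := by positivity
      linarith
    have h6 := hsec s r hrs hs.2
    have h7 : 0 < potSlope M a k ω Λ (rPlus M a) * (r - s) :=
      mul_pos (lt_of_lt_of_le (by positivity) hhor') (sub_pos.2 hs.2)
    -- Positive at `r₊` and negative at `s`: by concavity the slope can only be lower further out.
    have h8 : potSlope M a k ω Λ r ≤ potSlope M a k ω Λ s := by
      have : potSlope M a k ω Λ r * (s - rPlus M a) ≤ potSlope M a k ω Λ s * (s - rPlus M a) := by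
        have : potSlope M a k ω Λ s * (r - rPlus M a) ≤ potSlope M a k ω Λ s * (s - rPlus M a) :=
          mul_le_mul_of_nonpos_left (by linarith [hs.2]) hsp.le
        linarith
      exact le_of_mul_le_mul_right this (by linarith)
    refine Or.inr ⟨h', h8.trans_lt hsp, fun hR2 => h8.trans ?_⟩
    have h4 : -potSlope M a k ω Λ s * (r - r₂) ≤ -potSlope M a k ω Λ s * (2 * R) :=
      mul_le_mul_of_nonneg_left (by linarith [rPlus_pos haM]) (by linarith)
    have h5 : c₃ * Λ * (2 * R) ≤ -potSlope M a k ω Λ s * (2 * R) := by nlinarith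
    have := le_of_mul_le_mul_right h5 (by positivity)
    linarith

/-- Positivity of this function at `(γ, r)` means that `V₀ > ω²` at `r` for all admissible
frequencies with `ω / (a m) = γ`. -/
def superFun (M a γ r : ℝ) : ℝ :=
  min (Delta M a r) (a ^ 2 * (-(γ * (r ^ 2 + a ^ 2) - 1) ^ 2 - 2 * γ * Delta M a r) + Delta M a r)

theorem continuous_superFun : Continuous (Function.uncurry (superFun M a)) := by
  simp only [Function.uncurry_def, superFun, Delta]; fun_prop

theorem le_pot_sub (ha : a ≠ 0) {c γ k Λ r R : ℝ} (hc : 0 ≤ c) (hΛ : 0 ≤ Λ) (hk : k ^ 2 ≤ a ^ 2 * Λ)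
    (hr : 0 ≤ r) (hrR : r ≤ R) (h : c ≤ superFun M a γ r) :
    c / (R ^ 2 + a ^ 2) ^ 2 * Λ ≤ pot M a k (γ * k) Λ r - (γ * k) ^ 2 := by
  have hA := denom_pos ha r
  have hAR : (r ^ 2 + a ^ 2) ^ 2 ≤ (R ^ 2 + a ^ 2) ^ 2 := by gcongr
  have h1 := le_of_sq_le hk ha (h.trans (min_le_left _ _)) (h.trans (min_le_right _ _))
  have h2 := pot_sub_sq (M := M) ha k (γ * k) Λ r
  have h3 : c * Λ ≤ (r ^ 2 + a ^ 2) ^ 2 * (pot M a k (γ * k) Λ r - (γ * k) ^ 2) := by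
    rw [h2]; linarith
  have h4 : c * Λ / (r ^ 2 + a ^ 2) ^ 2 ≤ pot M a k (γ * k) Λ r - (γ * k) ^ 2 := by
    rw [div_le_iff₀ (by positivity)]; linarith
  refine le_trans ?_ h4
  rw [div_mul_eq_mul_div]
  gcongr

theorem superFun_pos_of_le (ha : a ≠ 0) (haM : |a| < M) {γ : ℝ} (h0 : 0 ≤ γ)
    (h : γ * ((5 * M) ^ 2 + a ^ 2) ≤ 1) : 0 < superFun M a γ (5 * M) := by
  have hM := mass_pos haM
  have haM2 := sq_lt_sq_mass haM
  have ha2 : 0 < a ^ 2 := by positivity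
  have hD : Delta M a (5 * M) = 15 * M ^ 2 + a ^ 2 := by unfold Delta; ring
  rw [superFun, lt_min_iff, hD]
  refine ⟨by positivity, ?_⟩
  have h1 : (γ * ((5 * M) ^ 2 + a ^ 2) - 1) ^ 2 ≤ 1 := by
    have : 0 ≤ γ * ((5 * M) ^ 2 + a ^ 2) := by positivity
    nlinarith
  have h2 : 2 * γ * (15 * M ^ 2 + a ^ 2) ≤ 2 := by nlinarith
  nlinarith

/-- At corotation the square drops out and `Δ (1 - 2 a² γ)` remains. -/
theorem superFun_pos_of_eq (haM : |a| < M) {γ r : ℝ} (hr : rPlus M a < r)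
    (hγ : γ ≤ gammaPlus M a) (h : γ * (r ^ 2 + a ^ 2) = 1) : 0 < superFun M a γ r := by
  have hD := Delta_pos haM hr
  have h1 := two_mul_gammaPlus_lt haM
  have h2 : 2 * a ^ 2 * γ < 1 := lt_of_le_of_lt (mul_le_mul_of_nonneg_left hγ (by positivity)) h1
  rw [superFun, lt_min_iff, h]
  refine ⟨hD, ?_⟩
  nlinarith [mul_pos hD (sub_pos.2 h2)]

/-- At the threshold the corotation radius is `r₊`, where `Δ = 0`. Slightly outside, `Δ` is of first
order in `r - r₊` while the square is of second order, so `Δ` wins. -/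
theorem exists_superFun_gammaPlus_pos (ha : a ≠ 0) (haM : |a| < M) :
    ∃ ρ > rPlus M a, ρ < 5 * M ∧ 0 < superFun M a (gammaPlus M a) ρ := by
  have hM := mass_pos haM
  have hlt := rPlus_lt ha haM
  have hp := mass_lt_rPlus haM
  have hsq := rPlus_sq haM
  have h1 := two_mul_gammaPlus_lt haM
  set γ := gammaPlus M a with hγ
  set p := rPlus M a with hpdef
  have hm : γ * (p ^ 2 + a ^ 2) = 1 := gammaPlus_mul haM
  have hcont : Continuous fun r : ℝ =>
      (r + p - 2 * M) * (1 - 2 * a ^ 2 * γ) - a ^ 2 * γ ^ 2 * (r - p) * (r + p) ^ 2 := by fun_prop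
  have h0 : 0 < (p + p - 2 * M) * (1 - 2 * a ^ 2 * γ) - a ^ 2 * γ ^ 2 * (p - p) * (p + p) ^ 2 := by
    rw [sub_self, mul_zero, zero_mul, sub_zero]
    exact mul_pos (by linarith) (by linarith)
  have hev : ∀ᶠ r in nhds p,
      0 < (r + p - 2 * M) * (1 - 2 * a ^ 2 * γ) - a ^ 2 * γ ^ 2 * (r - p) * (r + p) ^ 2 :=
    hcont.continuousAt.eventually (lt_mem_nhds h0)
  obtain ⟨δ, hδ, hb⟩ := Metric.eventually_nhds_iff.1 hev
  refine ⟨p + min (δ / 2) M, by have := lt_min (half_pos hδ) hM; linarith,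
    by linarith [min_le_right (δ / 2) M], ?_⟩
  set r := p + min (δ / 2) M with hrdef
  have hrp : p < r := by have := lt_min (half_pos hδ) hM; linarith
  have hbr := hb (y := r) (by
    rw [Real.dist_eq, abs_of_pos (by linarith)]; linarith [min_le_left (δ / 2) M])
  have hD := Delta_pos haM hrp
  rw [superFun, lt_min_iff]
  refine ⟨hD, ?_⟩
  have hDe : Delta M a r = (r - p) * (r + p - 2 * M) := by unfold Delta; linear_combination hsq
  have hAe : γ * (r ^ 2 + a ^ 2) - 1 = γ * (r - p) * (r + p) := by linear_combination hm
  rw [hAe, hDe]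
  have := mul_pos (sub_pos.2 hrp) hbr
  linarith

/-- The lower bound `l` is common to all ratios; it later keeps every interval beyond `r_pot`,
independently of `ε`. -/
theorem exists_superFun_pos (ha : a ≠ 0) (haM : |a| < M) :
    ∃ l > rPlus M a, l < 5 * M ∧ ∀ γ ∈ Icc 0 (gammaPlus M a), ∃ ρ ∈ Ioc l (5 * M), 0 < superFun M a γ ρ := by
  obtain ⟨ρ, hρ, hρ5, hpos⟩ := exists_superFun_gammaPlus_pos ha haM
  have hp := rPlus_pos haM
  have hγ0 := gammaPlus_pos haM
  have hc : Continuous fun γ => superFun M a γ ρ :=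
    continuous_superFun.comp (by fun_prop : Continuous fun γ : ℝ => (γ, ρ))
  obtain ⟨η, hη, hb⟩ := Metric.eventually_nhds_iff.1
    (hc.continuousAt.eventually (lt_mem_nhds hpos))
  have hm := gammaPlus_mul haM
  have hA := denom_pos ha (rPlus M a)
  have hc2 : Continuous fun r : ℝ => (gammaPlus M a - η / 2) * (r ^ 2 + a ^ 2) := by fun_prop
  have hlt : (gammaPlus M a - η / 2) * (rPlus M a ^ 2 + a ^ 2) < 1 := by nlinarith
  obtain ⟨δ, hδ, hd⟩ := Metric.eventually_nhds_iff.1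
    (hc2.continuousAt.eventually (gt_mem_nhds hlt))
  -- For `γ ≤ γ₊ - η / 2` the corotation radius lies beyond `l`; for larger `γ` the threshold radius
  -- `ρ` still works.
  set l := min (rPlus M a + δ / 2) ((rPlus M a + ρ) / 2) with hl
  have hl1 : rPlus M a < l := lt_min (by linarith) (by linarith)
  have hlρ : l < ρ := (min_le_right _ _).trans_lt (by linarith)
  have hl2 : (gammaPlus M a - η / 2) * (l ^ 2 + a ^ 2) < 1 := by
    apply hd
    rw [Real.dist_eq, abs_of_pos (by linarith)]
    linarith [min_le_left (rPlus M a + δ / 2) ((rPlus M a + ρ) / 2)]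
  refine ⟨l, hl1, hlρ.trans hρ5, fun γ hγ => ?_⟩
  rcases lt_or_ge (gammaPlus M a - η / 2) γ with h | h
  · refine ⟨ρ, ⟨hlρ, hρ5.le⟩, hb ?_⟩
    rw [Real.dist_eq, abs_lt]; constructor <;> linarith [hγ.2]
  · rcases le_or_gt (γ * ((5 * M) ^ 2 + a ^ 2)) 1 with h5 | h5
    · exact ⟨5 * M, ⟨hlρ.trans hρ5, le_rfl⟩, superFun_pos_of_le ha haM hγ.1 h5⟩
    · have hγpos : 0 < γ := by
        rcases hγ.1.eq_or_lt with h' | h'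
        · rw [← h'] at h5; linarith
        · exact h'
      have hll : γ * (l ^ 2 + a ^ 2) < 1 :=
        lt_of_le_of_lt (mul_le_mul_of_nonneg_right h (by positivity)) hl2
      have hcr : ContinuousOn (fun r : ℝ => γ * (r ^ 2 + a ^ 2)) (Icc l (5 * M)) := by fun_prop
      obtain ⟨r, hr, hre⟩ := intermediate_value_Icc (hlρ.trans hρ5).le hcr
        (show (1 : ℝ) ∈ Icc _ _ from ⟨hll.le, h5.le⟩)
      have hrl : l < r := by
        rcases hr.1.eq_or_lt with h' | h'
        · simp only [← h'] at hre; linarith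
        · exact h'
      exact ⟨r, ⟨hrl, hr.2⟩, superFun_pos_of_eq haM (hl1.trans hrl) hγ.2 hre⟩

theorem super_properties (ha : a ≠ 0) (haM : |a| < M) {c₁ c₀ C R : ℝ} (hc₁ : 0 < c₁) (hc₀ : 0 < c₀)
    (hC : 0 ≤ C) (hR : 0 < R) : ∃ b₀ > 0, ∀ b b' : ℝ, 0 < b → b ≤ b₀ → 0 < b' → b' ≤ b₀ →
    ∀ r₁ r₂ k ω Λ : ℝ, rPlus M a < r₁ → r₁ < r₂ → r₂ < R → 0 < Λ → ω ^ 2 ≤ C * Λ →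
      0 ≤ Λ * (rPlus M a - M) + 2 * M * (k * ω) → c₁ * Λ ≤ potSlope M a k ω Λ (rPlus M a) →
      (∀ r ∈ Icc r₁ r₂, c₀ * Λ ≤ pot M a k ω Λ r - ω ^ 2) →
      (∀ r, rPlus M a < r → pot M a k ω Λ r - ω ^ 2 < b * ω ^ 2 → 0 < pot' M a k ω Λ r → r < r₁) ∧
      (∀ r, rPlus M a < r → pot M a k ω Λ r - ω ^ 2 < b * ω ^ 2 → pot' M a k ω Λ r < 0 → r₂ < r) ∧
      (∀ r ∈ Icc r₁ r₂, b * ω ^ 2 ≤ pot M a k ω Λ r - ω ^ 2) ∧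
      (∀ r, rPlus M a < r → r < 2 * R → |pot M a k ω Λ r - ω ^ 2| ≤ b * ω ^ 2 →
        b' * Delta M a r * (r ^ 2)⁻¹ * ω ^ 2 < |pot' M a k ω Λ r|) ∧
      (∀ r, rPlus M a < r → pot' M a k ω Λ r = 0 → b * ω ^ 2 < pot M a k ω Λ r - ω ^ 2) := by
  obtain ⟨c₃, hc₃, hdi⟩ := potSlope_dichotomy ha haM hc₁ hc₀ hR
  obtain ⟨c₂, hc₂, hw⟩ := exists_weighted_le (a := a) (ρ := 2 * R) haM hc₃ hC
  -- The first entry makes `b ω² ≤ c₀ Λ / 2`, so that the dichotomy applies; the second fits the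
  -- weighted slope bound.
  refine ⟨min (c₀ / (2 * (C + 1))) c₂, lt_min (by positivity) hc₂, ?_⟩
  intro b b' hb hb₀ hb' hb'₀ r₁ r₂ k ω Λ hr₁ hr₁₂ hr₂ hΛ hω hconc hhor hI
  have hbω : b * ω ^ 2 ≤ c₀ / 2 * Λ := by
    have h1 : b ≤ c₀ / (2 * (C + 1)) := hb₀.trans (min_le_left _ _)
    calc b * ω ^ 2 ≤ c₀ / (2 * (C + 1)) * ((C + 1) * Λ) := by
          gcongr; linarith
      _ = c₀ / 2 * Λ := by field_simp
  have hdi' := hdi r₁ r₂ k ω Λ hr₁ hr₁₂ hr₂ hΛ hconc hhor hI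
  have hcΛ : 0 < c₃ * Λ := by positivity
  refine ⟨fun r hr hV hp => ?_, fun r hr hV hp => ?_, fun r hr => ?_, fun r hr hr2 hV => ?_,
    fun r hr hp => ?_⟩
  · rw [pot'_pos_iff ha haM hr] at hp
    rcases hdi' r hr (hV.le.trans hbω) with h | h
    · exact h.1
    · linarith [h.2.1]
  · rw [pot'_neg_iff ha haM hr] at hp
    rcases hdi' r hr (hV.le.trans hbω) with h | h
    · linarith [h.2]
    · exact h.1
  · have : 0 < c₀ * Λ := by positivity
    linarith [hI r hr]
  · have hD := Delta_pos haM hr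
    have hr0 : 0 < r := (rPlus_pos haM).trans hr
    have h2 : b' * Delta M a r * (r ^ 2)⁻¹ * ω ^ 2
        < c₂ * (Delta M a r * (r ^ 2)⁻¹ * (Λ + ω ^ 2)) := by
      have hX : 0 < Delta M a r * (r ^ 2)⁻¹ := by positivity
      have hbc : b' ≤ c₂ := hb'₀.trans (min_le_right _ _)
      calc b' * Delta M a r * (r ^ 2)⁻¹ * ω ^ 2 = b' * (Delta M a r * (r ^ 2)⁻¹ * ω ^ 2) := by ring
        _ ≤ c₂ * (Delta M a r * (r ^ 2)⁻¹ * ω ^ 2) := by gcongr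
        _ < _ := by
          apply mul_lt_mul_of_pos_left _ hc₂
          apply mul_lt_mul_of_pos_left _ hX
          linarith
    refine h2.trans_le ?_
    rcases hdi' r hr ((le_abs_self _).trans (hV.trans hbω)) with h | h
    · exact (hw Λ ω r _ hΛ.le hω hr hr2.le h.2).trans (le_abs_self _)
    · have h3 := hw Λ ω r (-potSlope M a k ω Λ r) hΛ.le hω hr hr2.le (by linarith [h.2.2 hr2])
      rw [mul_neg, neg_div] at h3
      exact h3.trans (neg_le_abs _)
  · by_contra! hcon
    rcases hdi' r hr (hcon.trans hbω) with h | h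
    · have := (pot'_pos_iff (k := k) (ω := ω) (Λ := Λ) ha haM hr).2 (hcΛ.trans_le h.2)
      linarith
    · have := (pot'_neg_iff (k := k) (ω := ω) (Λ := Λ) ha haM hr).2 h.2.1
      linarith

/-! ### Ratios close to zero, and ratios away from zero -/

theorem cubic_pos (ha : a ≠ 0) (haM : |a| < M) {r : ℝ} (hr : r ∈ Icc (rPlus M a) (2.1 * M)) :
    0 < cubic M a r := by
  have hM := mass_pos haM
  have h1 := mass_lt_rPlus haM
  have h2 := rPlus_lt ha haM
  have h3 := sq_lt_sq_mass haM
  have hp : 0 < cubic M a (rPlus M a) := by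
    rw [cubic_rPlus haM]
    have := rPlus_pos haM
    have := sub_pos.2 h1
    positivity
  have hq : 0 < cubic M a (2.1 * M) := by
    unfold cubic
    have h4 : 0 < M * (M ^ 2 - a ^ 2) := mul_pos hM (by linarith)
    have h5 : 0 < M ^ 3 := by positivity
    nlinarith
  have hs := trapFun_secant (M := M) (a := a) 0 (rPlus M a) r (2.1 * M)
  simp only [trapFun_zero] at hs
  have h5 : 0 < 2.1 * M - rPlus M a := by linarith
  have h6 : 0 ≤ (2.1 * M - rPlus M a) * (2.1 * M - r) * (r - rPlus M a)
      * (2 * (rPlus M a + r + 2.1 * M - 3 * M)) :=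
    mul_nonneg (mul_nonneg (mul_nonneg h5.le (by linarith [hr.2])) (by linarith [hr.1]))
      (by linarith [hr.1])
  have h7 : 0 < cubic M a (rPlus M a) * (2.1 * M - r) + cubic M a (2.1 * M) * (r - rPlus M a) := by
    rcases hr.1.eq_or_lt with h | h
    · rw [← h]; nlinarith
    · have := mul_nonneg hp.le (sub_nonneg.2 hr.2)
      have := mul_pos hq (sub_pos.2 h)
      linarith
  have : 0 < cubic M a r * (2.1 * M - rPlus M a) := by linarith
  exact pos_of_mul_pos_left this h5.le

theorem exists_le_cubic (ha : a ≠ 0) (haM : |a| < M) :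
    ∃ c > 0, ∀ r ∈ Icc (rPlus M a) (2.1 * M), c ≤ cubic M a r :=
  exists_pos_le isCompact_Icc (by unfold cubic; fun_prop) fun _ hr => cubic_pos ha haM hr

theorem sq_ratio_le {k Λ γ C : ℝ} (h : |k * (γ * k)| ≤ Λ) (hγ : |γ| ≤ C) :
    (γ * k) ^ 2 ≤ C * Λ := by
  have h1 : (γ * k) ^ 2 ≤ |γ| * |k * (γ * k)| := by
    rw [← abs_mul]
    exact (le_of_eq (by ring)).trans (le_abs_self _)
  have : 0 ≤ Λ := (abs_nonneg _).trans h
  exact h1.trans (mul_le_mul hγ h (abs_nonneg _) ((abs_nonneg _).trans hγ))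

/-- At `γ = 0` the numerator is at least `(Δ - a²) Λ = r (r - 2M) Λ`, which is at least `r² Λ / 201`
for `r ≥ 2.01M`. Half of this absorbs the `γ` term, and `(r² + a²)² ≤ 4 r⁴` turns `402` into `1608`.
-/
theorem le_pot_of_small_ratio (ha : a ≠ 0) (haM : |a| < M) {ε γ k Λ r : ℝ} (hε : 0 ≤ ε)
    (hεa : a ^ 2 * (4 * ε) < 1 / 1000) (hγ : -ε ≤ γ) (hΛ : 0 < Λ) (hk : k ^ 2 ≤ a ^ 2 * Λ)
    (hr : 2.01 * M ≤ r) : Λ / (1608 * r ^ 2) ≤ pot M a k (γ * k) Λ r := by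
  have hM := mass_pos haM
  have haM2 := sq_lt_sq_mass haM
  have hr0 : 0 < r := by linarith
  have hA := denom_pos ha r
  have e1 : Λ * r ^ 2 / 402 ≤ 4 * M * r * k * (γ * k) - k ^ 2 + Delta M a r * Λ := by
    have e2 : -(ε * (a ^ 2 * Λ)) ≤ γ * k ^ 2 := by
      have h1 : ε * k ^ 2 ≤ ε * (a ^ 2 * Λ) := by gcongr
      have h2 : -ε * k ^ 2 ≤ γ * k ^ 2 := by gcongr
      linarith
    have e3 : 4 * M * r * (-(ε * (a ^ 2 * Λ))) ≤ 4 * M * r * (γ * k ^ 2) := by gcongr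
    have e4 : a ^ 2 * (4 * ε) * (M * r * Λ) ≤ 1 / 1000 * (M * r * Λ) := by gcongr
    have e5 : 0 ≤ (r - 2.01 * M) * (r * Λ) := mul_nonneg (by linarith) (by positivity)
    have e7 : 0 < Λ * r ^ 2 := by positivity
    unfold Delta
    linarith
  have e6 : (r ^ 2 + a ^ 2) ^ 2 ≤ (2 * r ^ 2) ^ 2 := by
    apply pow_le_pow_left₀ hA.le
    nlinarith
  calc Λ / (1608 * r ^ 2) = (Λ * r ^ 2 / 402) / (2 * r ^ 2) ^ 2 := by field_simp; norm_num
    _ ≤ (Λ * r ^ 2 / 402) / (r ^ 2 + a ^ 2) ^ 2 := by gcongr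
    _ ≤ _ := by unfold pot; gcongr

/-- The estimates for frequencies with `ω / (a m)` close to `0`. -/
theorem small_ratio_properties (ha : a ≠ 0) (haM : |a| < M) (R : ℝ) :
    ∃ ε > 0, ∃ c₀ > 0, ∀ γ k Λ : ℝ, |γ| < ε → 0 < Λ → k ^ 2 ≤ a ^ 2 * Λ → |k * (γ * k)| ≤ Λ →
      (∀ r ∈ Ioc (rPlus M a) (2.1 * M),
        c₀ * (Delta M a r * (r ^ 2)⁻¹ * (Λ + (γ * k) ^ 2)) ≤ pot' M a k (γ * k) Λ r) ∧
      (∀ r ∈ Ici (2.01 * M), c₀ * ((r ^ 2)⁻¹ * (Λ + (γ * k) ^ 2)) ≤ pot M a k (γ * k) Λ r) ∧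
      (∀ r ∈ Icc (2.01 * M) (1.2 * R), 1 / 2 * (γ * k) ^ 2 < pot M a k (γ * k) Λ r) := by
  have hM := mass_pos haM
  have haM2 := sq_lt_sq_mass haM
  have ha2 : 0 < a ^ 2 := by positivity
  obtain ⟨c, hc, hcub⟩ := exists_le_cubic ha haM
  obtain ⟨c₂, hc₂, hw⟩ := exists_weighted_le (a := a) (ρ := 2.1 * M) (C := 1) haM (half_pos hc)
    zero_le_one
  have hev : ∀ᶠ ε in nhdsWithin (0 : ℝ) (Ioi 0), a ^ 2 * (ε * (12 * M * (2.1 * M) ^ 2)) < c / 2 ∧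
      ε < 1 ∧ a ^ 2 * (4 * ε) < 1 / 1000 ∧ ε ^ 2 * a ^ 2 * (1.2 * R) ^ 2 * 804 < 1 ∧
      ε ^ 2 * a ^ 2 < 1 := by
    apply Filter.Eventually.filter_mono nhdsWithin_le_nhds
    refine Filter.Eventually.and ?_ (Filter.Eventually.and ?_ (Filter.Eventually.and ?_
      (Filter.Eventually.and ?_ ?_)))
    all_goals
      refine ContinuousAt.eventually_lt (by fun_prop) (by fun_prop) ?_
      norm_num
    linarith
  obtain ⟨ε, ⟨h1, h2, h3, h4, h5⟩, hε⟩ := (hev.and self_mem_nhdsWithin).exists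
  -- `3216 = 2 * 1608`, the factor `2` coming from `ω² ≤ Λ`.
  refine ⟨ε, hε, min c₂ (1 / 3216), lt_min hc₂ (by norm_num), fun γ k Λ hγ hΛ hk hkω => ?_⟩
  have hγl := (abs_lt.1 hγ).1
  have hγr := (abs_lt.1 hγ).2
  have hω : (γ * k) ^ 2 ≤ ε ^ 2 * a ^ 2 * Λ := by
    have : γ ^ 2 ≤ ε ^ 2 := sq_le_sq' hγl.le hγr.le
    calc (γ * k) ^ 2 = γ ^ 2 * k ^ 2 := by ring
      _ ≤ ε ^ 2 * (a ^ 2 * Λ) := by gcongr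
      _ = _ := by ring
  have hω1 : (γ * k) ^ 2 ≤ 1 * Λ := hω.trans (mul_le_mul_of_nonneg_right h5.le hΛ.le)
  have hV : ∀ r, 2.01 * M ≤ r → Λ / (1608 * r ^ 2) ≤ pot M a k (γ * k) Λ r := fun r hr =>
    le_pot_of_small_ratio ha haM hε.le h3 hγl.le hΛ hk hr
  refine ⟨fun r hr => ?_, fun r hr => ?_, fun r hr => ?_⟩
  · have hD := Delta_pos haM hr.1
    have hr0 : 0 < r := (rPlus_pos haM).trans hr.1
    refine le_trans ?_ (hw Λ (γ * k) r _ hΛ.le hω1 hr.1 hr.2 ?_)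
    · gcongr; exact min_le_left _ _
    · have hcu := hcub r ⟨hr.1.le, hr.2⟩
      refine le_potSlope ha hk (by linarith) ?_
      have e1 : -(ε * (12 * M * (2.1 * M) ^ 2)) ≤ γ * (4 * M * a ^ 2 - 12 * M * r ^ 2) := by
        have e0 : r ^ 2 ≤ (2.1 * M) ^ 2 := by gcongr; exact hr.2
        have e2 : a ^ 2 ≤ r ^ 2 := by
          have := mass_lt_rPlus haM
          have := hr.1
          nlinarith
        have e3 : |γ| * |4 * M * a ^ 2 - 12 * M * r ^ 2| ≤ ε * (12 * M * (2.1 * M) ^ 2) := by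
          apply mul_le_mul hγ.le _ (abs_nonneg _) hε.le
          have e4 := mul_le_mul_of_nonneg_left e0 hM.le
          have e5 := mul_le_mul_of_nonneg_left e2 hM.le
          have e6 : 0 ≤ M * a ^ 2 := by positivity
          rw [abs_le]
          constructor <;> linarith
        rw [← abs_mul] at e3
        linarith [(abs_le.1 e3).1]
      have e4 := mul_le_mul_of_nonneg_left e1 ha2.le
      have e5 : 0 < a ^ 2 * (4 * r) := by positivity
      linarith
  · have hr0 : 0 < r := by linarith [mem_Ici.1 hr]
    refine le_trans ?_ (hV r hr)
    calc min c₂ (1 / 3216) * ((r ^ 2)⁻¹ * (Λ + (γ * k) ^ 2)) ≤ 1 / 3216 * ((r ^ 2)⁻¹ * (Λ + 1 * Λ)) := by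
          gcongr; exact min_le_right _ _
      _ = _ := by field_simp; norm_num
  · have hr0 : 0 < r := by linarith [hr.1]
    refine lt_of_lt_of_le ?_ (hV r hr.1)
    rw [lt_div_iff₀ (by positivity)]
    have e1 : r ^ 2 ≤ (1.2 * R) ^ 2 := by gcongr; exact hr.2
    calc 1 / 2 * (γ * k) ^ 2 * (1608 * r ^ 2)
        ≤ 1 / 2 * (ε ^ 2 * a ^ 2 * Λ) * (1608 * (1.2 * R) ^ 2) := by gcongr
      _ = (ε ^ 2 * a ^ 2 * (1.2 * R) ^ 2 * 804) * Λ := by ring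
      _ < 1 * Λ := by gcongr
      _ = Λ := one_mul _

/-- Solve the definition of `V₀` for `Δ Λ`. The remaining terms are multiples of `k²`, controlled by
`ω²` because `γ` stays away from `0`; this is why the first range is left out. -/
theorem exists_le_sq_add_pot (ha : a ≠ 0) (haM : |a| < M) {γ₀ R : ℝ} (hγ₀ : 0 < γ₀) (hR : 0 < R) :
    ∃ c > 0, ∀ γ k Λ r : ℝ, γ₀ ≤ |γ| → 0 ≤ Λ → r ∈ Icc (rPlus M a) R →
      (γ * k) ^ 2 ≤ pot M a k (γ * k) Λ r →
      c * (Delta M a r * Λ) ≤ (γ * k) ^ 2 + pot M a k (γ * k) Λ r := by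
  have hM := mass_pos haM
  refine ⟨((R ^ 2 + a ^ 2) ^ 2 + 4 * M * R / γ₀ + 1 / γ₀ ^ 2)⁻¹, by positivity,
    fun γ k Λ r hγ hΛ hr hV => ?_⟩
  have hr0 : 0 < r := (rPlus_pos haM).trans_le hr.1
  have hA := denom_pos ha r
  have hV0 : 0 ≤ pot M a k (γ * k) Λ r := (sq_nonneg _).trans hV
  have h1 : Delta M a r * Λ =
      (r ^ 2 + a ^ 2) ^ 2 * pot M a k (γ * k) Λ r + 4 * M * r * (-γ * k ^ 2) + k ^ 2 := by
    unfold pot; field_simp; ring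
  have hk : k ^ 2 ≤ 1 / γ₀ ^ 2 * (γ * k) ^ 2 := by
    rw [div_mul_eq_mul_div, le_div_iff₀ (by positivity), one_mul, mul_pow, mul_comm]
    have : γ₀ ^ 2 ≤ γ ^ 2 := by rw [← sq_abs γ]; gcongr
    gcongr
  have hk2 : -γ * k ^ 2 ≤ 1 / γ₀ * (γ * k) ^ 2 := by
    rw [div_mul_eq_mul_div, le_div_iff₀ (by positivity), one_mul]
    have e1 : -γ * γ₀ ≤ γ ^ 2 := by
      rw [← sq_abs γ]
      nlinarith [neg_le_abs γ, abs_nonneg γ]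
    nlinarith [sq_nonneg k]
  rw [inv_mul_le_iff₀ (by positivity), h1]
  have e1 : (r ^ 2 + a ^ 2) ^ 2 * pot M a k (γ * k) Λ r ≤ (R ^ 2 + a ^ 2) ^ 2 * pot M a k (γ * k) Λ r := by
    gcongr; exact hr.2
  have e2 : 4 * M * r * (-γ * k ^ 2) ≤ 4 * M * R * (1 / γ₀ * (γ * k) ^ 2) := by
    calc 4 * M * r * (-γ * k ^ 2) ≤ 4 * M * r * (1 / γ₀ * (γ * k) ^ 2) := by gcongr
      _ ≤ _ := by gcongr; exact hr.2
  have e3 : 0 ≤ (R ^ 2 + a ^ 2) ^ 2 * (γ * k) ^ 2 := by positivity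
  have e4 : 0 ≤ (4 * M * R / γ₀ + 1 / γ₀ ^ 2) * pot M a k (γ * k) Λ r := by positivity
  have e5 : 4 * M * R * (1 / γ₀ * (γ * k) ^ 2) = 4 * M * R / γ₀ * (γ * k) ^ 2 := by ring
  nlinarith

/-! ### The non-superradiant range -/

/-- For frequencies with `a m / ω = t`, the radii where trapping may occur are separated by `c` from
the complement of `(r₁, r₂)`. -/
def TrapSep (M a c t r₁ r₂ : ℝ) : Prop :=
  (∀ r, rPlus M a < r → r ≤ r₁ + c →
    (c ≤ r ^ 2 + a ^ 2 - t ∧ c ≤ trapFun M a t r) ∨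
      ∀ ω Λ, (t * ω) ^ 2 ≤ a ^ 2 * Λ → c * Λ ≤ potSlope M a (t * ω) ω Λ r) ∧
  (∀ r, rPlus M a < r → r₂ - c ≤ r → r ≤ 10 * M →
    c ≤ r ^ 2 + a ^ 2 - t ∧ trapFun M a t r ≤ -c)

theorem TrapSep.mono {c c' t r₁ r₂ : ℝ} (h : TrapSep M a c t r₁ r₂) (hc : c' ≤ c)
    (ha : a ≠ 0) : TrapSep M a c' t r₁ r₂ := by
  refine ⟨fun r hr hr1 => ?_, fun r hr hr2 hr3 => ?_⟩
  · rcases h.1 r hr (by linarith) with h1 | h1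
    · exact Or.inl ⟨hc.trans h1.1, hc.trans h1.2⟩
    · refine Or.inr fun ω Λ hΛ => le_trans ?_ (h1 ω Λ hΛ)
      have : 0 ≤ Λ := by
        have ha2 : 0 < a ^ 2 := by positivity
        exact nonneg_of_mul_nonneg_right ((sq_nonneg _).trans hΛ) ha2
      gcongr
  · have := h.2 r hr (by linarith) hr3
    exact ⟨by linarith, by linarith⟩

/-- Quantitative form of `Delta_mul_potSlope`: the term with `V₀ - ω²` takes at most half of the
main one. The sign `σ` treats both sides of the trapped radius at once. -/
theorem exists_trap_bound (ha : a ≠ 0) (haM : |a| < M) {c R : ℝ} (hc : 0 < c) (hR : 0 < R) :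
    ∃ b₀ > 0, ∀ b b' : ℝ, b ≤ b₀ → b' ≤ b₀ → ∀ t ω Λ r σ : ℝ, |σ| = 1 →
      rPlus M a < r → r ≤ R → c ≤ σ * ((r ^ 2 + a ^ 2 - t) * trapFun M a t r) →
      |pot M a (t * ω) ω Λ r - ω ^ 2| < b * ω ^ 2 →
      b' * Delta M a r * (r ^ 2)⁻¹ * ω ^ 2 ≤ σ * pot' M a (t * ω) ω Λ r := by
  have hM := mass_pos haM
  have hp := rPlus_pos haM
  set G := 2 * R ^ 3 + 6 * M * R ^ 2 + 2 * a ^ 2 * R + 2 * M * a ^ 2 with hG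
  have hG0 : 0 < G := by positivity
  refine ⟨min (c / (2 * G * (R ^ 2 + a ^ 2))) (c * rPlus M a ^ 2 / (2 * (R ^ 2 + a ^ 2) ^ 4)),
    lt_min (by positivity) (by positivity), fun b b' hb hb' t ω Λ r σ hσ hr hrR hq hV => ?_⟩
  have hr0 : 0 < r := hp.trans hr
  have hA := denom_pos ha r
  have hAR : r ^ 2 + a ^ 2 ≤ R ^ 2 + a ^ 2 := by gcongr
  have hD := Delta_pos haM hr
  have hDA : Delta M a r ≤ r ^ 2 + a ^ 2 := by unfold Delta; nlinarith
  have hg : |cubic M a r| ≤ G := by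
    have h1 : r ^ 3 ≤ R ^ 3 := by gcongr
    have h2 : M * r ^ 2 ≤ M * R ^ 2 := by gcongr
    have h3 : a ^ 2 * r ≤ a ^ 2 * R := by gcongr
    have h4 : 0 < r ^ 3 := by positivity
    have h5 : 0 ≤ M * r ^ 2 := by positivity
    have h6 : 0 ≤ a ^ 2 * r := by positivity
    have h7 : 0 ≤ M * a ^ 2 := by positivity
    unfold cubic; rw [abs_le]; constructor <;> linarith
  have hb1 : b * (2 * G * (R ^ 2 + a ^ 2)) ≤ c := by
    rw [← le_div_iff₀ (by positivity)]; exact hb.trans (min_le_left _ _)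
  have hb2 : b' * (2 * (R ^ 2 + a ^ 2) ^ 4) ≤ c * rPlus M a ^ 2 := by
    rw [← le_div_iff₀ (by positivity)]; exact hb'.trans (min_le_right _ _)
  have hkey := Delta_mul_potSlope (M := M) ha (t * ω) ω Λ r
  have herr : -(G * ((r ^ 2 + a ^ 2) ^ 2 * (b * ω ^ 2))) ≤
      σ * (cubic M a r * ((r ^ 2 + a ^ 2) ^ 2 * (pot M a (t * ω) ω Λ r - ω ^ 2))) := by
    apply neg_le_of_abs_le
    rw [abs_mul, abs_mul, abs_mul, hσ, one_mul, abs_of_pos (by positivity : 0 < (r ^ 2 + a ^ 2) ^ 2)]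
    gcongr
  have hb3 : G * ((r ^ 2 + a ^ 2) ^ 2 * (b * ω ^ 2)) ≤ (r ^ 2 + a ^ 2) * ω ^ 2 * (c / 2) := by
    have hbpos : 0 ≤ b * ω ^ 2 := (abs_nonneg _).trans hV.le
    rcases eq_or_ne ω 0 with rfl | hω
    · simp
    have hω2 : 0 < ω ^ 2 := by positivity
    have hb0 : 0 ≤ b := nonneg_of_mul_nonneg_left hbpos hω2
    have : b * (G * (r ^ 2 + a ^ 2)) ≤ c / 2 := by
      have : b * (G * (r ^ 2 + a ^ 2)) ≤ b * (G * (R ^ 2 + a ^ 2)) := by gcongr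
      linarith
    calc G * ((r ^ 2 + a ^ 2) ^ 2 * (b * ω ^ 2))
        = (r ^ 2 + a ^ 2) * ω ^ 2 * (b * (G * (r ^ 2 + a ^ 2))) := by ring
      _ ≤ _ := by gcongr
  have hmain : (r ^ 2 + a ^ 2) * ω ^ 2 * (c / 2) ≤ σ * (Delta M a r * potSlope M a (t * ω) ω Λ r) := by
    have h1 : (r ^ 2 + a ^ 2) * ω ^ 2 * c
        ≤ (r ^ 2 + a ^ 2) * ω ^ 2 * (σ * ((r ^ 2 + a ^ 2 - t) * trapFun M a t r)) := by gcongr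
    have h2 : σ * ((r ^ 2 + a ^ 2) * (ω * (r ^ 2 + a ^ 2) - t * ω)
        * (ω * cubic M a r - 2 * (r - M) * (t * ω)))
        = (r ^ 2 + a ^ 2) * ω ^ 2 * (σ * ((r ^ 2 + a ^ 2 - t) * trapFun M a t r)) := by
      unfold trapFun; ring
    rw [hkey, mul_add, h2]
    linarith
  have hfin : (r ^ 2 + a ^ 2) * ω ^ 2 * (c / 2) / (r ^ 2 + a ^ 2) ^ 4 ≤ σ * pot' M a (t * ω) ω Λ r := by
    rw [pot', ← mul_div_assoc σ, div_le_div_iff_of_pos_right (by positivity)]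
    exact hmain
  refine le_trans ?_ hfin
  have h3 : b' * (2 * (r ^ 2 + a ^ 2) ^ 4) ≤ c * r ^ 2 := by
    rcases le_total b' 0 with h | h
    · have : b' * (2 * (r ^ 2 + a ^ 2) ^ 4) ≤ 0 := mul_nonpos_of_nonpos_of_nonneg h (by positivity)
      have : 0 ≤ c * r ^ 2 := by positivity
      linarith
    · calc b' * (2 * (r ^ 2 + a ^ 2) ^ 4) ≤ b' * (2 * (R ^ 2 + a ^ 2) ^ 4) := by gcongr
        _ ≤ c * rPlus M a ^ 2 := hb2
        _ ≤ _ := by gcongr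
  rcases le_total b' 0 with h | h
  · have h5 : b' * (Delta M a r * (r ^ 2)⁻¹ * ω ^ 2) ≤ 0 :=
      mul_nonpos_of_nonpos_of_nonneg h (by positivity)
    have h6 : 0 ≤ (r ^ 2 + a ^ 2) * ω ^ 2 * (c / 2) / (r ^ 2 + a ^ 2) ^ 4 := by positivity
    linarith
  calc b' * Delta M a r * (r ^ 2)⁻¹ * ω ^ 2 ≤ b' * (r ^ 2 + a ^ 2) * (r ^ 2)⁻¹ * ω ^ 2 := by gcongr
    _ = b' * (2 * (r ^ 2 + a ^ 2) ^ 4) * (ω ^ 2 * (r ^ 2)⁻¹ / (2 * (r ^ 2 + a ^ 2) ^ 3)) := by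
        field_simp
    _ ≤ c * r ^ 2 * (ω ^ 2 * (r ^ 2)⁻¹ / (2 * (r ^ 2 + a ^ 2) ^ 3)) := by gcongr
    _ = _ := by field_simp

/-- Near `V₀ = ω²` one has `ω² ≤ 2 V₀`, while `V₀ ≤ 3 Λ / a²` always. This replaces a bound on the
ratio, which is unbounded here. -/
theorem sq_le_of_abs_pot_sub_lt (ha : a ≠ 0) (haM : |a| < M) {b k ω Λ r : ℝ} (hb : b ≤ 1 / 2)
    (hr : rPlus M a < r) (hΛ : |k * ω| ≤ Λ) (hV : |pot M a k ω Λ r - ω ^ 2| < b * ω ^ 2) :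
    ω ^ 2 ≤ 6 / a ^ 2 * Λ := by
  have hM := mass_pos haM
  have hp := mass_lt_rPlus haM
  have hA := denom_pos ha r
  have h0 : 0 ≤ Λ := (abs_nonneg _).trans hΛ
  have h1 : ω ^ 2 ≤ 2 * pot M a k ω Λ r := by
    have := (abs_lt.1 hV).1
    nlinarith [sq_nonneg ω]
  have h2 : pot M a k ω Λ r ≤ 3 / a ^ 2 * Λ := by
    unfold pot
    rw [div_le_iff₀ (by positivity)]
    have e1 : 4 * M * r * (k * ω) ≤ 4 * M * r * Λ := by
      have : 0 < r := by linarith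
      have := (le_abs_self _).trans hΛ
      gcongr
    have e2 : (r ^ 2 + a ^ 2) * Λ ≤ 1 / a ^ 2 * Λ * (r ^ 2 + a ^ 2) ^ 2 := by
      have : 1 ≤ 1 / a ^ 2 * (r ^ 2 + a ^ 2) := by
        rw [div_mul_eq_mul_div, one_mul, le_div_iff₀ (by positivity)]
        nlinarith [sq_nonneg r]
      calc (r ^ 2 + a ^ 2) * Λ = 1 * ((r ^ 2 + a ^ 2) * Λ) := by ring
        _ ≤ 1 / a ^ 2 * (r ^ 2 + a ^ 2) * ((r ^ 2 + a ^ 2) * Λ) := by gcongr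
        _ = _ := by ring
    have e3 : 4 * M * r * Λ + Delta M a r * Λ ≤ 3 * ((r ^ 2 + a ^ 2) * Λ) := by
      have : 4 * M * r + Delta M a r ≤ 3 * (r ^ 2 + a ^ 2) := by
        unfold Delta; nlinarith [sq_nonneg a]
      nlinarith
    have e4 : 3 / a ^ 2 * Λ * (r ^ 2 + a ^ 2) ^ 2 = 3 * (1 / a ^ 2 * Λ * (r ^ 2 + a ^ 2) ^ 2) := by ring
    rw [e4]
    nlinarith [sq_nonneg k]
  calc ω ^ 2 ≤ 2 * (3 / a ^ 2 * Λ) := by linarith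
    _ = _ := by ring

/-- The term `-2 r³ Λ` dominates using only `|kω| ≤ Λ` and `k² ≤ a² Λ`. Hence `TrapSep` need only
control radii up to `10M`. -/
theorem potSlope_le_of_far (haM : |a| < M) {k ω Λ r : ℝ} (hk : k ^ 2 ≤ a ^ 2 * Λ)
    (hΛ : |k * ω| ≤ Λ) (hr : 10 * M ≤ r) : potSlope M a k ω Λ r ≤ -(M ^ 3 * Λ) := by
  have hM := mass_pos haM
  have haM2 := sq_lt_sq_mass haM
  have h0 : 0 ≤ Λ := (abs_nonneg _).trans hΛ
  have hr0 : 0 < r := by linarith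
  have ha2 : a ^ 2 ≤ r ^ 2 := by nlinarith
  have h1 : k * ω * (4 * M * a ^ 2 - 12 * M * r ^ 2) ≤ Λ * (12 * M * r ^ 2) := by
    have e1 : |k * ω| * |4 * M * a ^ 2 - 12 * M * r ^ 2| ≤ Λ * (12 * M * r ^ 2) := by
      apply mul_le_mul hΛ _ (abs_nonneg _) h0
      have := mul_le_mul_of_nonneg_left ha2 hM.le
      have : 0 ≤ M * a ^ 2 := by positivity
      rw [abs_le]; constructor <;> linarith
    rw [← abs_mul] at e1
    exact (le_abs_self _).trans e1
  have h2 : 4 * r * k ^ 2 ≤ 4 * r * (a ^ 2 * Λ) := by gcongr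
  have h3 : cubic M a r + 12 * M * r ^ 2 + 4 * r * a ^ 2 ≤ -M ^ 3 := by
    unfold cubic
    have e1 : r * a ^ 2 ≤ r * M ^ 2 := by gcongr
    have e2 : 0 ≤ M * a ^ 2 := by positivity
    have e3 : 0 ≤ (r - 10 * M) * r ^ 2 := mul_nonneg (by linarith) (by positivity)
    have e4 : 0 ≤ (r - 10 * M) * (M * r) := mul_nonneg (by linarith) (by positivity)
    have e5 : 0 ≤ (r - 10 * M) * M ^ 2 := mul_nonneg (by linarith) (by positivity)
    have e6 : 0 < M ^ 3 := by positivity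
    nlinarith
  have h4 := mul_le_mul_of_nonneg_right h3 h0
  unfold potSlope
  nlinarith

theorem nonsuper_properties (ha : a ≠ 0) (haM : |a| < M) {c R : ℝ} (hc : 0 < c) (hR : 10 * M ≤ R) :
    ∃ b₀ > 0, ∀ b b' : ℝ, b ≤ b₀ → b' ≤ b₀ → ∀ t r₁ r₂ ω Λ : ℝ, TrapSep M a c t r₁ r₂ → r₁ + c ≤ R →
      ω ≠ 0 → (t * ω) ^ 2 ≤ a ^ 2 * Λ → |t * ω * ω| ≤ Λ →
      ∀ r, rPlus M a < r → |pot M a (t * ω) ω Λ r - ω ^ 2| < b * ω ^ 2 →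
        (r ≤ r₁ + c → b' * Delta M a r * (r ^ 2)⁻¹ * ω ^ 2 ≤ pot' M a (t * ω) ω Λ r) ∧
        (r₂ - c ≤ r → pot' M a (t * ω) ω Λ r < 0 ∧
          (r ≤ R → pot' M a (t * ω) ω Λ r ≤ -(b' * Delta M a r * (r ^ 2)⁻¹ * ω ^ 2))) := by
  have hM := mass_pos haM
  have hR0 : 0 < R := by linarith
  obtain ⟨b₁, hb₁, htrap⟩ := exists_trap_bound ha haM (sq_pos_of_pos hc) hR0
  obtain ⟨b₂, hb₂, hw⟩ := exists_weighted_le (a := a) (ρ := R) (C := 6 / a ^ 2) haM hc (by positivity)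
  obtain ⟨b₃, hb₃, hw'⟩ := exists_weighted_le (a := a) (ρ := R) (C := 6 / a ^ 2) haM
    (by positivity : 0 < M ^ 3) (by positivity)
  refine ⟨min (min b₁ (1 / 2)) (min b₂ b₃), lt_min (lt_min hb₁ (by norm_num)) (lt_min hb₂ hb₃), ?_⟩
  intro b b' hb hb' t r₁ r₂ ω Λ hsep hr₁ hω hk hΛ r hr hV
  simp only [le_min_iff] at hb hb'
  have h0 : 0 ≤ Λ := (abs_nonneg _).trans hΛ
  have hωΛ := sq_le_of_abs_pot_sub_lt ha haM hb.1.2 hr hΛ hV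
  have hω2 : 0 < ω ^ 2 := by positivity
  have hΛ0 : 0 < Λ := by
    have ha2 : 0 < 6 / a ^ 2 := by positivity
    exact pos_of_mul_pos_right (hω2.trans_le hωΛ) ha2.le
  have hD := Delta_pos haM hr
  have hr0 : 0 < r := (rPlus_pos haM).trans hr
  have hdrop : ∀ β, b' ≤ β → 0 < β → b' * Delta M a r * (r ^ 2)⁻¹ * ω ^ 2 ≤
      β * (Delta M a r * (r ^ 2)⁻¹ * (Λ + ω ^ 2)) := by
    intro β hβ hβ0
    calc b' * Delta M a r * (r ^ 2)⁻¹ * ω ^ 2 = b' * (Delta M a r * (r ^ 2)⁻¹ * ω ^ 2) := by ring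
      _ ≤ β * (Delta M a r * (r ^ 2)⁻¹ * ω ^ 2) := by gcongr
      _ ≤ _ := by gcongr; linarith
  refine ⟨fun h => ?_, fun h => ?_⟩
  · rcases hsep.1 r hr h with h1 | h1
    · have := htrap b b' hb.1.1 hb'.1.1 t ω Λ r 1 abs_one hr (h.trans hr₁)
        (by rw [one_mul, sq]; exact mul_le_mul h1.1 h1.2 hc.le (hc.le.trans h1.1)) hV
      rwa [one_mul] at this
    · exact (hdrop b₂ hb'.2.1 hb₂).trans (hw Λ ω r _ h0 hωΛ hr (h.trans hr₁) (h1 ω Λ hk))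
  · rcases le_total r (10 * M) with h10 | h10
    · obtain ⟨h1, h2⟩ := hsep.2 r hr h h10
      have hmain : ∀ β ≤ b₁, β * Delta M a r * (r ^ 2)⁻¹ * ω ^ 2 ≤ -1 * pot' M a (t * ω) ω Λ r :=
        fun β hβ => htrap b β hb.1.1 hβ t ω Λ r (-1) (by simp) hr (h10.trans hR)
          (by
            have := mul_le_mul h1 (neg_le_neg h2) (by linarith) (hc.le.trans h1)
            rw [neg_neg] at this
            linarith) hV
      refine ⟨?_, fun _ => by linarith [hmain b' hb'.1.1]⟩
      have h3 := hmain b₁ le_rfl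
      have : 0 < b₁ * Delta M a r * (r ^ 2)⁻¹ * ω ^ 2 := by positivity
      linarith
    · have h1 := potSlope_le_of_far haM hk hΛ h10
      have : 0 < M ^ 3 * Λ := by positivity
      refine ⟨(pot'_neg_iff ha haM hr).2 (by linarith), fun hrR => ?_⟩
      have h2 := (hdrop b₃ hb'.2.2 hb₃).trans
        (hw' Λ ω r (-potSlope M a (t * ω) ω Λ r) h0 hωΛ hr hrR (by linarith))
      rw [mul_neg, neg_div] at h2
      unfold pot'
      linarith

/-! ### Timelike Killing fields -/

/-- Positivity of this function means that `T + a x Ω₁` is timelike at radius `r`. -/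
def timeFun (M a x r : ℝ) : ℝ :=
  Delta M a r * (1 - a ^ 2 * x) ^ 2 - a ^ 2 * (1 - (r ^ 2 + a ^ 2) * x) ^ 2

/-- With `s = sin² θ` the numerator of `-g` is smallest at the equator `s = 1`, where it is
`timeFun`. This needs `a² x ≤ 1`, supplied by `x ≤ γ₊`. -/
theorem metric_le (haM : |a| < M) {c x r R θ : ℝ} (hx : 0 ≤ x) (hx' : x ≤ gammaPlus M a)
    (hr : rPlus M a < r) (hrR : r ≤ R) (hc : 0 ≤ c) (h : c ≤ timeFun M a x r) :
    metric M a r θ (T + (a * x) • Omega1) (T + (a * x) • Omega1) ≤ -(c / (R ^ 2 + a ^ 2)) := by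
  have hr0 : 0 < r := (rPlus_pos haM).trans hr
  have hD := Delta_pos haM hr
  have hρ : 0 < rhoSq a r θ := by unfold rhoSq; positivity
  have hρR : rhoSq a r θ ≤ R ^ 2 + a ^ 2 := by
    have h1 : a ^ 2 * Real.cos θ ^ 2 ≤ a ^ 2 * 1 := by gcongr; exact Real.cos_sq_le_one θ
    have h2 : r ^ 2 ≤ R ^ 2 := by gcongr
    unfold rhoSq; linarith
  set s := Real.sin θ ^ 2 with hs
  have hs0 : 0 ≤ s := sq_nonneg _
  have hs1 : s ≤ 1 := Real.sin_sq_le_one θ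
  have hm : metric M a r θ (T + (a * x) • Omega1) (T + (a * x) • Omega1) =
      -((Delta M a r * (1 - a ^ 2 * (s * x)) ^ 2 - s * (a ^ 2 * (1 - (r ^ 2 + a ^ 2) * x) ^ 2))
        / rhoSq a r θ) := by
    simp only [metric, T, Omega1, Pi.add_apply, Pi.smul_apply, smul_eq_mul]
    simp [← hs]
    field_simp
    ring
  have hax : a ^ 2 * x ≤ 1 := by
    have h1 := two_mul_gammaPlus_lt haM
    have h2 : a ^ 2 * x ≤ a ^ 2 * gammaPlus M a := by gcongr
    have h3 : 0 ≤ a ^ 2 * gammaPlus M a := by have := gammaPlus_pos haM; positivity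
    linarith
  have hnum : c ≤ Delta M a r * (1 - a ^ 2 * (s * x)) ^ 2
      - s * (a ^ 2 * (1 - (r ^ 2 + a ^ 2) * x) ^ 2) := by
    refine h.trans ?_
    unfold timeFun
    have e1 : (1 - a ^ 2 * x) ^ 2 ≤ (1 - a ^ 2 * (s * x)) ^ 2 := by
      apply pow_le_pow_left₀ (by linarith)
      have : s * x ≤ 1 * x := by gcongr
      have : a ^ 2 * (s * x) ≤ a ^ 2 * (1 * x) := by gcongr
      linarith
    have e2 := mul_le_mul_of_nonneg_left e1 hD.le
    have e3 : s * (a ^ 2 * (1 - (r ^ 2 + a ^ 2) * x) ^ 2)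
        ≤ 1 * (a ^ 2 * (1 - (r ^ 2 + a ^ 2) * x) ^ 2) := by gcongr
    linarith
  rw [hm, neg_le_neg_iff]
  exact div_le_div₀ (hc.trans hnum) hnum hρ hρR

/-! ### Wells of convex functions -/

/-- If the bound failed at `r`, the whole segment from `p` to `r` would lie in the well. There
`dχ/dr*` vanishes at `p` and has `r`-derivative at least `κ`, since `Δ / (r² + a²) ≤ 1`; two
integrations give the contradiction. -/
theorem le_of_convex_well (haM : |a| < M) (ha : a ≠ 0) {f : ℝ → ℝ} {κ p : ℝ} (hκ : 0 < κ)
    (hf : ContDiffOn ℝ (⊤ : ℕ∞) f (Ioi (rPlus M a))) (hp : rPlus M a < p) (hfp : f p = 0)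
    (hnn : ∀ r, rPlus M a < r → 0 ≤ f r)
    (hconv : ∀ r, rPlus M a < r → f r ≤ 1 / 2 → κ ≤ rStarDeriv M a (rStarDeriv M a f) r)
    (hord : OrdConnected {r | rPlus M a < r ∧ f r ≤ 1 / 2}) {r : ℝ} (hr : rPlus M a < r) :
    min (1 / 2) (κ / 2 * (r - p) ^ 2) ≤ f r := by
  by_contra! hcon
  have hfr : f r ≤ 1 / 2 := hcon.le.trans (min_le_left _ _)
  have hmem : ∀ s ∈ uIcc p r, rPlus M a < s ∧ f s ≤ 1 / 2 := fun s hs =>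
    hord.uIcc_subset ⟨hp, by rw [hfp]; norm_num⟩ ⟨hr, hfr⟩ hs
  have hdf : ∀ s, rPlus M a < s → DifferentiableAt ℝ f s := fun s hs =>
    (hf.differentiableOn (by simp)).differentiableAt (Ioi_mem_nhds hs)
  have hddf : ∀ s, rPlus M a < s → DifferentiableAt ℝ (deriv f) s := fun s hs => by
    have h1 : ContDiffOn ℝ 1 (deriv f) (Ioi (rPlus M a)) :=
      hf.deriv_of_isOpen isOpen_Ioi (WithTop.coe_le_coe.2 (le_top : (1 + 1 : ℕ∞) ≤ ⊤))
    exact (h1.differentiableOn (by simp)).differentiableAt (Ioi_mem_nhds hs)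
  set g := rStarDeriv M a f with hg
  have hdg : ∀ s, rPlus M a < s → DifferentiableAt ℝ g s := fun s hs => by
    have hA := denom_pos ha s
    have : DifferentiableAt ℝ (fun r => Delta M a r / (r ^ 2 + a ^ 2)) s := by
      unfold Delta
      exact DifferentiableAt.div (by fun_prop) (by fun_prop) hA.ne'
    exact this.mul (hddf s hs)
  have hquot : ∀ s, rPlus M a < s → 0 < Delta M a s / (s ^ 2 + a ^ 2) ∧
      Delta M a s / (s ^ 2 + a ^ 2) ≤ 1 := fun s hs => by
    have hA := denom_pos ha s
    have hD := Delta_pos haM hs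
    refine ⟨by positivity, (div_le_one hA).2 ?_⟩
    have := mul_pos (mass_pos haM) ((rPlus_pos haM).trans hs)
    unfold Delta; linarith
  have hg' : ∀ s ∈ uIcc p r, κ ≤ deriv g s := fun s hs => by
    obtain ⟨h1, h2⟩ := hmem s hs
    have h3 : κ ≤ Delta M a s / (s ^ 2 + a ^ 2) * deriv g s := hconv s h1 h2
    obtain ⟨h4, h5⟩ := hquot s h1
    have h6 : 0 < deriv g s := pos_of_mul_pos_right (hκ.trans_le h3) h4.le
    nlinarith
  have hgp : g p = 0 := by
    have hmin : IsLocalMin f p := by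
      filter_upwards [Ioi_mem_nhds hp] with s hs
      rw [hfp]; exact hnn s hs
    rw [hg, rStarDeriv, hmin.deriv_eq_zero, mul_zero]
  set h : ℝ → ℝ := fun s => f s - κ / 2 * (s - p) ^ 2 with hh
  have hdh : ∀ s, rPlus M a < s → HasDerivAt h (deriv f s - κ * (s - p)) s := fun s hs => by
    have h1 := (((hasDerivAt_id' s).sub_const p).pow 2).const_mul (κ / 2)
    refine ((hdf s hs).hasDerivAt.sub h1).congr_deriv ?_
    norm_num
    ring
  have hhp : h p = 0 := by simp [hh, hfp]
  have hhr : h r < 0 := by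
    have := hcon.trans_le (min_le_right _ _)
    simp only [hh]; linarith
  have hcont : ContinuousOn h (uIcc p r) := fun s hs =>
    (hdh s (hmem s hs).1).continuousAt.continuousWithinAt
  rcases le_total p r with hpr | hpr
  · rw [uIcc_of_le hpr] at *
    have hmono : MonotoneOn h (Icc p r) := by
      refine monotoneOn_of_deriv_nonneg (convex_Icc p r) hcont
        (fun s hs => (hdh s (hmem s (interior_subset hs)).1).differentiableAt.differentiableWithinAt)
        fun s hs => ?_
      have hs' := interior_subset hs
      have hs1 := (hmem s hs').1
      rw [(hdh s hs1).deriv]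
      have h1 : κ * (s - p) ≤ g s - g p := (convex_Icc p r).mul_sub_le_image_sub_of_le_deriv
        (fun u hu => (hdg u (hmem u hu).1).continuousAt.continuousWithinAt)
        (fun u hu => (hdg u (hmem u (interior_subset hu)).1).differentiableWithinAt)
        (fun u hu => hg' u (interior_subset hu)) p ⟨le_rfl, hpr⟩ s hs' hs'.1
      rw [hgp, sub_zero] at h1
      obtain ⟨h4, h5⟩ := hquot s hs1
      have h6 : g s = Delta M a s / (s ^ 2 + a ^ 2) * deriv f s := rfl
      have h7 : 0 ≤ κ * (s - p) := mul_nonneg hκ.le (sub_nonneg.2 hs'.1)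
      have h8 : 0 ≤ deriv f s := by
        by_contra! hneg
        nlinarith
      nlinarith
    have := hmono ⟨le_rfl, hpr⟩ ⟨hpr, le_rfl⟩ hpr
    linarith
  · rw [uIcc_of_ge hpr] at *
    have hanti : AntitoneOn h (Icc r p) := by
      refine antitoneOn_of_deriv_nonpos (convex_Icc r p) hcont
        (fun s hs => (hdh s (hmem s (interior_subset hs)).1).differentiableAt.differentiableWithinAt)
        fun s hs => ?_
      have hs' := interior_subset hs
      have hs1 := (hmem s hs').1
      rw [(hdh s hs1).deriv]
      have h1 : κ * (p - s) ≤ g p - g s := (convex_Icc r p).mul_sub_le_image_sub_of_le_deriv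
        (fun u hu => (hdg u (hmem u hu).1).continuousAt.continuousWithinAt)
        (fun u hu => (hdg u (hmem u (interior_subset hu)).1).differentiableWithinAt)
        (fun u hu => hg' u (interior_subset hu)) s hs' p ⟨hpr, le_rfl⟩ hs'.2
      rw [hgp, zero_sub] at h1
      obtain ⟨h4, h5⟩ := hquot s hs1
      have h6 : g s = Delta M a s / (s ^ 2 + a ^ 2) * deriv f s := rfl
      have h7 : 0 ≤ κ * (p - s) := mul_nonneg hκ.le (sub_nonneg.2 hs'.2)
      have h8 : deriv f s ≤ 0 := by
        by_contra! hpos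
        nlinarith
      nlinarith
    have := hanti ⟨le_rfl, hpr⟩ ⟨hpr, le_rfl⟩ hpr
    linarith

/-! ### Radii and Killing fields for non-superradiant ratios -/

/-- The data `x, r₁, r₂` are suitable for all non-superradiant frequencies with
`ω / (a m) ∈ J`. -/
def TrapPiece (M a c : ℝ) (J : Set ℝ) (x r₁ r₂ : ℝ) : Prop :=
  0 ≤ x ∧ x ≤ gammaPlus M a ∧ r₁ + c < r₂ ∧ (∀ r ∈ Ioo r₁ r₂, c ≤ timeFun M a x r) ∧
    ∀ γ ∈ J, TrapSep M a c γ⁻¹ r₁ r₂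

theorem TrapPiece.mono (ha : a ≠ 0) {c c' x r₁ r₂ : ℝ} {J J' : Set ℝ}
    (h : TrapPiece M a c J x r₁ r₂) (hc : c' ≤ c) (hJ : J' ⊆ J) : TrapPiece M a c' J' x r₁ r₂ :=
  ⟨h.1, h.2.1, by linarith [h.2.2.1], fun r hr => hc.trans (h.2.2.2.1 r hr),
    fun γ hγ => (h.2.2.2.2 γ (hJ hγ)).mono hc ha⟩

theorem exists_pos_le_six {x y z u v w : ℝ} (hx : 0 < x) (hy : 0 < y) (hz : 0 < z) (hu : 0 < u)
    (hv : 0 < v) (hw : 0 < w) : ∃ c > 0, c ≤ x ∧ c ≤ y ∧ c ≤ z ∧ c ≤ u ∧ c ≤ v ∧ c ≤ w := by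
  refine ⟨min x (min y (min z (min u (min v w)))), ?_, ?_⟩
  · simp only [gt_iff_lt, lt_min_iff]
    exact ⟨hx, hy, hz, hu, hv, hw⟩
  · simp only [← le_min_iff, le_refl]

theorem continuous_trapFun : Continuous (Function.uncurry (trapFun M a)) := by
  simp only [Function.uncurry_def, trapFun, cubic]; fun_prop

theorem continuous_timeFun (x : ℝ) : Continuous (timeFun M a x) := by
  unfold timeFun Delta; fun_prop

theorem trapFun_rPlus (haM : |a| < M) (t : ℝ) :
    trapFun M a t (rPlus M a) = 2 * (rPlus M a - M) * (rPlus M a ^ 2 + a ^ 2 - t) := by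
  rw [trapFun, cubic_rPlus haM, rPlus_sq haM]; ring

/-- At the threshold `r₊` is itself a root of `trapFun`, and the remaining quadratic factor is
positive outside the horizon. -/
theorem trapFun_neg_of_eq (haM : |a| < M) {r : ℝ} (hr : rPlus M a < r) :
    trapFun M a (rPlus M a ^ 2 + a ^ 2) r < 0 := by
  have hp := mass_lt_rPlus haM
  have hsq := rPlus_sq haM
  have hM := mass_pos haM
  set p := rPlus M a
  have h1 : trapFun M a (p ^ 2 + a ^ 2) r
      = -2 * ((r - p) * (r ^ 2 + p * r - 3 * M * r + M * p)) := by
    have : a ^ 2 = 2 * M * p - p ^ 2 := by linarith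
    unfold trapFun cubic; rw [this]; ring
  have h2 : 0 < r ^ 2 + p * r - 3 * M * r + M * p := by
    nlinarith [mul_pos (sub_pos.2 hr) (sub_pos.2 hp), mul_pos (sub_pos.2 hp) (hM.trans hp),
      sq_nonneg (r - p)]
  have := mul_pos (sub_pos.2 hr) h2
  linarith

theorem trapFun_pos_left (haM : |a| < M) {t ρ r : ℝ} (ht : t < rPlus M a ^ 2 + a ^ 2)
    (hρ : trapFun M a t ρ = 0) (hr : rPlus M a ≤ r) (hrρ : r < ρ) : 0 < trapFun M a t r := by
  have hp := mass_lt_rPlus haM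
  have hs := trapFun_secant (M := M) (a := a) t (rPlus M a) r ρ
  have h0 : 0 < trapFun M a t (rPlus M a) := by
    rw [trapFun_rPlus haM]; exact mul_pos (by linarith) (by linarith)
  rw [hρ, zero_mul, add_zero] at hs
  have h1 : 0 ≤ (ρ - rPlus M a) * (ρ - r) * (r - rPlus M a) * (2 * (rPlus M a + r + ρ - 3 * M)) :=
    mul_nonneg (mul_nonneg (mul_nonneg (by linarith) (by linarith)) (by linarith)) (by linarith)
  have h2 := mul_pos h0 (sub_pos.2 hrρ)
  have h3 : 0 < trapFun M a t r * (ρ - rPlus M a) := by linarith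
  exact pos_of_mul_pos_left h3 (by linarith)

theorem trapFun_neg_right (haM : |a| < M) {t ρ r : ℝ} (ht : t < rPlus M a ^ 2 + a ^ 2)
    (hρ : trapFun M a t ρ = 0) (hpρ : rPlus M a < ρ) (hρr : ρ < r) : trapFun M a t r < 0 := by
  have hp := mass_lt_rPlus haM
  have hs := trapFun_secant (M := M) (a := a) t (rPlus M a) ρ r
  have h0 : 0 < trapFun M a t (rPlus M a) := by
    rw [trapFun_rPlus haM]; exact mul_pos (by linarith) (by linarith)
  rw [hρ, zero_mul] at hs
  have h1 : 0 ≤ (r - rPlus M a) * (r - ρ) * (ρ - rPlus M a) * (2 * (rPlus M a + ρ + r - 3 * M)) :=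
    mul_nonneg (mul_nonneg (mul_nonneg (by linarith) (by linarith)) (by linarith)) (by linarith)
  have h2 := mul_pos h0 (sub_pos.2 hρr)
  by_contra! hcon
  have h3 := mul_nonneg hcon (sub_pos.2 hpρ).le
  linarith

theorem timeFun_inv_pos (ha : a ≠ 0) (haM : |a| < M) {ρ : ℝ} (hρ : rPlus M a < ρ) :
    0 < timeFun M a (ρ ^ 2 + a ^ 2)⁻¹ ρ := by
  have hA := denom_pos ha ρ
  have hD := Delta_pos haM hρ
  have hρ0 : 0 < ρ := (rPlus_pos haM).trans hρ
  have h1 : 1 - a ^ 2 * (ρ ^ 2 + a ^ 2)⁻¹ = ρ ^ 2 / (ρ ^ 2 + a ^ 2) := by field_simp; ring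
  rw [timeFun, mul_inv_cancel₀ hA.ne', h1]
  have : 0 < Delta M a ρ * (ρ ^ 2 / (ρ ^ 2 + a ^ 2)) ^ 2 := by positivity
  linarith

theorem inv_le_gammaPlus (ha : a ≠ 0) (haM : |a| < M) {ρ : ℝ} (hρ : rPlus M a < ρ) :
    (ρ ^ 2 + a ^ 2)⁻¹ ≤ gammaPlus M a := by
  have hp := rPlus_pos haM
  have := denom_pos ha (rPlus M a)
  rw [← inv_inv (gammaPlus M a), inv_gammaPlus haM]
  gcongr

theorem inv_lt_of_gammaPlus_lt (haM : |a| < M) {γ : ℝ} (hγ : gammaPlus M a < γ) :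
    γ⁻¹ < rPlus M a ^ 2 + a ^ 2 := by
  rw [← inv_gammaPlus haM]
  exact inv_strictAnti₀ (gammaPlus_pos haM) hγ

theorem exists_le_timeFun_inv (ha : a ≠ 0) (haM : |a| < M) {ρ l u : ℝ} (hρ : rPlus M a < ρ)
    (h : ρ ∈ Ioo l u) : ∃ r₁ r₂, l < r₁ ∧ r₁ < ρ ∧ ρ < r₂ ∧ r₂ < u ∧ ∃ c > 0,
      ∀ r ∈ Icc r₁ r₂, c ≤ timeFun M a (ρ ^ 2 + a ^ 2)⁻¹ r := by
  have hF : Continuous (Function.uncurry fun _ : ℝ => timeFun M a (ρ ^ 2 + a ^ 2)⁻¹) :=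
    (continuous_timeFun _).comp continuous_snd
  -- The family does not depend on its parameter; `0` is a dummy base point.
  obtain ⟨r₁, r₂, h1, h2, h3, h4, c, hc, hev⟩ :=
    continuous_tube_Icc hF (x₀ := 0) h (timeFun_inv_pos ha haM hρ)
  exact ⟨r₁, r₂, h1, h2, h3, h4, c, hc, hev.self_of_nhds⟩

/-- The non-superradiant frequencies close to the threshold. -/
theorem exists_threshold_piece (ha : a ≠ 0) (haM : |a| < M) :
    ∃ ε > 0, ∃ c > 0, ∃ x r₁ r₂, rPlus M a < r₁ ∧ r₂ < 11 * M ∧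
      TrapPiece M a c (Ioo (gammaPlus M a) (gammaPlus M a + ε)) x r₁ r₂ := by
  have hM := mass_pos haM
  have hp2 := rPlus_lt ha haM
  have hp := rPlus_pos haM
  obtain ⟨ρ, hρ, ε₁, hε₁, c₁, hc₁, hsl⟩ := exists_le_potSlope ha haM
  -- At the threshold the zero of `trapFun` has moved to the horizon, so any `q` slightly outside
  -- `r₊` serves. Up to `ρ` the slope bound holds regardless of `V₀ ≈ ω²`; beyond `q`, `trapFun` is
  -- negative.
  set m := min ρ (3 * M) with hm
  have hpm : rPlus M a < m := lt_min hρ (by linarith)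
  set q := (rPlus M a + m) / 2 with hq
  have hq1 : rPlus M a < q := by linarith
  have hq2 : q < m := by linarith
  obtain ⟨r₁, r₂, h1, h2, h3, h4, c₂, hc₂, htime⟩ := exists_le_timeFun_inv ha haM hq1
    (show q ∈ Ioo (rPlus M a) m from ⟨hq1, hq2⟩)
  obtain ⟨c₃, hc₃, hev3⟩ := continuous_tube (F := fun t r => -trapFun M a t r)
    (by have := continuous_trapFun (M := M) (a := a)
        exact this.neg) (isCompact_Icc (a := q) (b := 10 * M))
    (x₀ := (gammaPlus M a)⁻¹) (fun r hr => by
      rw [inv_gammaPlus haM]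
      linarith [trapFun_neg_of_eq haM (hq1.trans_le hr.1)])
  have hev4 := (continuousAt_inv₀ (gammaPlus_pos haM).ne').eventually hev3
  obtain ⟨ε₂, hε₂, hb⟩ := Metric.eventually_nhds_iff.1 hev4
  obtain ⟨c, hc0, hcc₁, hcc₂, hcc₃, hcq, hcd1, hcd2⟩ := exists_pos_le_six hc₁ hc₂ hc₃
    (show 0 < q ^ 2 - rPlus M a ^ 2 by nlinarith)
    (show 0 < (q - r₁) / 2 by linarith) (show 0 < (r₂ - q) / 2 by linarith)
  have hmρ : m ≤ ρ := min_le_left _ _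
  have hm3 : m ≤ 3 * M := min_le_right _ _
  refine ⟨min ε₁ ε₂, lt_min hε₁ hε₂, c, hc0, (q ^ 2 + a ^ 2)⁻¹, r₁, r₂, h1, by linarith,
    by positivity, inv_le_gammaPlus ha haM hq1, by linarith,
    fun r hr => hcc₂.trans (htime r ⟨hr.1.le, hr.2.le⟩), fun γ hγ => ⟨fun r hr hr1 => Or.inr ?_,
      fun r hr hr2 hr3 => ?_⟩⟩
  · intro ω Λ hk
    have hγ0 : 0 < γ := (gammaPlus_pos haM).trans hγ.1
    have h := hsl γ (hγ.2.le.trans (by gcongr; exact min_le_left _ _)) r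
      ⟨hr.le, by linarith⟩ (γ⁻¹ * ω) Λ hk
    rw [mul_inv_cancel_left₀ hγ0.ne'] at h
    refine le_trans ?_ h
    have : 0 ≤ Λ := by
      have ha2 : 0 < a ^ 2 := by positivity
      exact nonneg_of_mul_nonneg_right ((sq_nonneg _).trans hk) ha2
    gcongr
  · have hqr : q ≤ r := by linarith
    have ht := inv_lt_of_gammaPlus_lt haM hγ.1
    have h := hb (y := γ) (by
      rw [Real.dist_eq, abs_of_pos (sub_pos.2 hγ.1)]
      linarith [hγ.2, min_le_right ε₁ ε₂]) r ⟨hqr, hr3⟩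
    have hqr2 : q ^ 2 ≤ r ^ 2 := pow_le_pow_left₀ (hp.trans hq1).le hqr 2
    exact ⟨by linarith, by linarith⟩

/-- The non-superradiant frequencies close to a given one. -/
theorem exists_middle_piece (ha : a ≠ 0) (haM : |a| < M) {γ₀ l : ℝ} (hγ₀ : gammaPlus M a < γ₀)
    (hl : rPlus M a < l) (hl3 : l < 3 * M) (hQ : 0 < trapFun M a γ₀⁻¹ l) :
    ∃ c > 0, ∃ U ∈ nhds γ₀, ∃ x r₁ r₂, l < r₁ ∧ r₂ < 11 * M ∧ TrapPiece M a c U x r₁ r₂ := by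
  have hM := mass_pos haM
  have hp := rPlus_pos haM
  have hγpos : 0 < γ₀ := (gammaPlus_pos haM).trans hγ₀
  have hA := inv_lt_of_gammaPlus_lt haM hγ₀
  set t₀ := γ₀⁻¹ with ht₀
  have ht0 : 0 < t₀ := inv_pos.2 hγpos
  have h3 : trapFun M a t₀ (3 * M) < 0 := by
    have : 0 < M * a ^ 2 := by positivity
    have h' : trapFun M a t₀ (3 * M) = -8 * (M * a ^ 2) - 4 * (M * t₀) := by
      unfold trapFun cubic; ring
    have := mul_pos hM ht0
    linarith
  have hcQ : Continuous (trapFun M a t₀) := by unfold trapFun cubic; fun_prop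
  -- `ρ` is the trapped radius; the uniform sign bounds are taken off a neighbourhood of it.
  obtain ⟨ρ, hρ, hρ0⟩ := intermediate_value_Ioo' hl3.le hcQ.continuousOn
    (show (0 : ℝ) ∈ Ioo _ _ from ⟨h3, hQ⟩)
  have hpρ : rPlus M a < ρ := hl.trans hρ.1
  obtain ⟨r₁, r₂, h1, h2, h3, h4, c₂, hc₂, htime⟩ := exists_le_timeFun_inv ha haM hpρ hρ
  obtain ⟨c₁, hc₁, hev1⟩ := continuous_tube continuous_trapFun
    (isCompact_Icc (a := rPlus M a) (b := (r₁ + ρ) / 2)) (x₀ := t₀)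
    (fun r hr => trapFun_pos_left haM hA hρ0 hr.1 (by linarith [hr.2]))
  obtain ⟨c₃, hc₃, hev3⟩ := continuous_tube (F := fun t r => -trapFun M a t r)
    (by have := continuous_trapFun (M := M) (a := a)
        exact this.neg) (isCompact_Icc (a := (ρ + r₂) / 2) (b := 10 * M)) (x₀ := t₀)
    (fun r hr => neg_pos.2 (trapFun_neg_right haM hA hρ0 hpρ (by linarith [hr.1])))
  set e := (rPlus M a ^ 2 + a ^ 2 - t₀) / 2 with he
  have he0 : 0 < e := by linarith
  have hev4 : ∀ᶠ t in nhds t₀, t < t₀ + e := gt_mem_nhds (by linarith)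
  have hevall := (continuousAt_inv₀ hγpos.ne').eventually (hev1.and (hev3.and hev4))
  obtain ⟨c, hc0, hcc₁, hcc₂, hcc₃, hce, hcd1, hcd2⟩ := exists_pos_le_six hc₁ hc₂ hc₃ he0
    (show 0 < (ρ - r₁) / 2 by linarith) (show 0 < (r₂ - ρ) / 2 by linarith)
  refine ⟨c, hc0, {γ | _}, hevall, (ρ ^ 2 + a ^ 2)⁻¹, r₁, r₂, h1, by linarith, by positivity,
    inv_le_gammaPlus ha haM hpρ, by linarith, fun r hr => hcc₂.trans (htime r ⟨hr.1.le, hr.2.le⟩),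
    fun γ hγ => ?_⟩
  obtain ⟨g1, g2, g3⟩ := hγ
  have hAt : ∀ r, rPlus M a < r → c ≤ r ^ 2 + a ^ 2 - γ⁻¹ := fun r hr => by
    have : rPlus M a ^ 2 ≤ r ^ 2 := by gcongr
    linarith
  refine ⟨fun r hr hr1 => Or.inl ⟨hAt r hr, hcc₁.trans (g1 r ⟨hr.le, by linarith⟩)⟩,
    fun r hr hr2 hr3 => ⟨hAt r hr, ?_⟩⟩
  linarith [g2 r ⟨by linarith, hr3⟩]

/-- The frequencies for which `|ω|` is large compared to `|a m|`, and those of counter-rotating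
type. -/
theorem exists_trapSep_of_le (ha : a ≠ 0) (haM : |a| < M) :
    ∃ τ > 0, ∃ c > 0, (∀ t ≤ τ, TrapSep M a c t (2.05 * M) (11 * M)) ∧
      2.05 * M + c < 11 * M ∧ ∀ r ∈ Ioo (2.05 * M) (11 * M), c ≤ timeFun M a 0 r := by
  have hM := mass_pos haM
  have hp := rPlus_pos haM
  have hpM := mass_lt_rPlus haM
  obtain ⟨c₁, hc₁, hcub⟩ := exists_le_cubic ha haM
  have hA := denom_pos ha (rPlus M a)
  set A := rPlus M a ^ 2 + a ^ 2 with hAdef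
  -- Up to `2.1M` one has `2 (r - M) ≤ 2.2M`, so `τ` lets the `t` term consume at most half of `c₁`.
  set τ := min (A / 2) (c₁ / (2 * (2.2 * M))) with hτ
  have hτA : τ ≤ A / 2 := min_le_left _ _
  have hτc : 2.2 * M * τ ≤ c₁ / 2 := by
    have : τ ≤ c₁ / (2 * (2.2 * M)) := min_le_right _ _
    rw [le_div_iff₀ (by positivity)] at this
    linarith
  have hτ0 : 0 < τ := lt_min (by linarith) (by positivity)
  obtain ⟨c, hc0, hcA, hcc, hcM, hcM2, -, -⟩ := exists_pos_le_six (half_pos hA) (half_pos hc₁)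
    (show 0 < 0.05 * M by linarith) (show 0 < 0.1 * M ^ 2 by positivity) hM hM
  refine ⟨τ, hτ0, c, hc0, fun t ht => ⟨fun r hr hr1 => Or.inl ⟨?_, ?_⟩, fun r hr hr2 hr3 => ?_⟩,
    by linarith, fun r hr => ?_⟩
  · have : rPlus M a ^ 2 ≤ r ^ 2 := by gcongr
    linarith
  · have h1 := hcub r ⟨hr.le, by linarith⟩
    have h2 : 2 * (r - M) * t ≤ 2.2 * M * τ := by
      have h3 : 2 * (r - M) * t ≤ 2 * (r - M) * τ :=
        mul_le_mul_of_nonneg_left ht (by linarith)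
      have h4 : 2 * (r - M) * τ ≤ 2.2 * M * τ := mul_le_mul_of_nonneg_right (by linarith) hτ0.le
      linarith
    unfold trapFun
    linarith
  -- The right-hand clause is vacuous: `11M - c > 10M`.
  · exfalso; linarith
  · have h1 : timeFun M a 0 r = r * (r - 2 * M) := by unfold timeFun Delta; ring
    rw [h1]
    have := hr.1
    nlinarith

/-! ### Finite coverings -/

/-- Compactness induction: finite unions append the lists and take the smaller constant, which `hP`
permits. -/
theorem exists_list_cover {β : Type*} {P : ℝ → Set ℝ → β → Prop}
    (hP : ∀ c c' J J' y, P c J y → c' ≤ c → J' ⊆ J → P c' J' y) {p' p q q' : ℝ} (hp : p' < p)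
    (hq : q < q') (hloc : ∀ γ ∈ Icc p q, ∃ c > 0, ∃ U ∈ nhds γ, ∃ y, P c U y) :
    ∃ c > 0, ∃ L : List (Set ℝ × β), (∀ e ∈ L, IsOpen e.1 ∧ IsConnected e.1 ∧ e.1 ⊆ Ioo p' q' ∧
      P c e.1 e.2) ∧ ∀ γ ∈ Icc p q, ∃ e ∈ L, γ ∈ e.1 := by
  refine (isCompact_Icc (a := p) (b := q)).induction_on
    (p := fun s => ∃ c > 0, ∃ L : List (Set ℝ × β), (∀ e ∈ L, IsOpen e.1 ∧ IsConnected e.1 ∧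
      e.1 ⊆ Ioo p' q' ∧ P c e.1 e.2) ∧ ∀ γ ∈ s, ∃ e ∈ L, γ ∈ e.1) ?_ ?_ ?_ ?_
  · exact ⟨1, one_pos, [], by simp, by simp⟩
  · rintro s t hst ⟨c, hc, L, hL, hcov⟩
    exact ⟨c, hc, L, hL, fun γ hγ => hcov γ (hst hγ)⟩
  · rintro s t ⟨c, hc, L, hL, hcov⟩ ⟨c', hc', L', hL', hcov'⟩
    refine ⟨min c c', lt_min hc hc', L ++ L', fun e he => ?_, fun γ hγ => ?_⟩
    · rcases List.mem_append.1 he with he | he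
      · obtain ⟨h1, h2, h3, h4⟩ := hL e he
        exact ⟨h1, h2, h3, hP _ _ _ _ _ h4 (min_le_left _ _) Subset.rfl⟩
      · obtain ⟨h1, h2, h3, h4⟩ := hL' e he
        exact ⟨h1, h2, h3, hP _ _ _ _ _ h4 (min_le_right _ _) Subset.rfl⟩
    · rcases hγ with hγ | hγ
      · obtain ⟨e, he, h⟩ := hcov γ hγ
        exact ⟨e, List.mem_append_left _ he, h⟩
      · obtain ⟨e, he, h⟩ := hcov' γ hγ
        exact ⟨e, List.mem_append_right _ he, h⟩
  · intro γ hγ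
    obtain ⟨c, hc, U, hU, y, hy⟩ := hloc γ hγ
    have hV : U ∩ Ioo p' q' ∈ nhds γ :=
      Filter.inter_mem hU (Ioo_mem_nhds (hp.trans_le hγ.1) (hγ.2.trans_lt hq))
    obtain ⟨δ, hδ, hball⟩ := Metric.mem_nhds_iff.1 hV
    refine ⟨Metric.ball γ δ, mem_nhdsWithin_of_mem_nhds (Metric.ball_mem_nhds γ hδ), c, hc,
      [(Metric.ball γ δ, y)], ?_, ?_⟩
    · intro e he
      rw [List.mem_singleton] at he
      subst he
      refine ⟨Metric.isOpen_ball, ?_, fun z hz => (hball hz).2,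
        hP _ _ _ _ _ hy le_rfl fun z hz => (hball hz).1⟩
      simp only [Real.ball_eq_Ioo]
      exact isConnected_Ioo (by linarith)
    · exact fun z hz => ⟨_, List.mem_singleton_self _, hz⟩

theorem exists_enumeration {β : Type*} (e₁ e₂ : β) (L : List β) (L' : List β) (f g : β) :
    ∃ (Ns N : ℕ) (D : ℕ → β), 2 ≤ Ns ∧ Ns + 2 ≤ N ∧ D 1 = e₁ ∧ D 2 = e₂ ∧
      (∀ n ∈ Icc 3 Ns, D n ∈ L) ∧ (∀ e ∈ L, ∃ n ∈ Icc 3 Ns, D n = e) ∧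
      (∀ n ∈ Icc (Ns + 1) (N - 2), D n ∈ L') ∧ (∀ e ∈ L', ∃ n ∈ Icc (Ns + 1) (N - 2), D n = e) ∧
      D (N - 1) = f ∧ D N = g := by
  -- Positions: `e₁, e₂`, then `L` from `3`, then `L'` from `L.length + 3`, then `f, g`. The `getD`
  -- default `e₁` is never reached, the indices being in bounds.
  refine ⟨L.length + 2, L.length + L'.length + 4, fun n =>
    if n = 1 then e₁ else if n = 2 then e₂ else if n ≤ L.length + 2 then L.getD (n - 3) e₁ else
    if n ≤ L.length + L'.length + 2 then L'.getD (n - (L.length + 3)) e₁ else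
    if n = L.length + L'.length + 3 then f else g, by omega, by omega, by simp, by simp,
    ?_, ?_, ?_, ?_, ?_, ?_⟩
  · intro n hn
    obtain ⟨h1, h2⟩ := hn
    have h3 : n - 3 < L.length := by omega
    simp only [show n ≠ 1 by omega, show n ≠ 2 by omega, h2, if_true, if_false]
    rw [List.getD_eq_getElem _ _ h3]
    exact List.getElem_mem h3
  · intro e he
    obtain ⟨i, hi, rfl⟩ := List.getElem_of_mem he
    refine ⟨i + 3, ⟨by omega, by omega⟩, ?_⟩
    simp only [show i + 3 ≠ 1 by omega, show i + 3 ≠ 2 by omega, show i + 3 ≤ L.length + 2 by omega,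
      if_true, if_false, Nat.add_sub_cancel]
    rw [List.getD_eq_getElem _ _ hi]
  · intro n hn
    obtain ⟨h1, h2⟩ := hn
    have h3 : n - (L.length + 3) < L'.length := by omega
    simp only [show n ≠ 1 by omega, show n ≠ 2 by omega, show ¬ n ≤ L.length + 2 by omega,
      show n ≤ L.length + L'.length + 2 by omega, if_true, if_false]
    rw [List.getD_eq_getElem _ _ h3]
    exact List.getElem_mem h3
  · intro e he
    obtain ⟨i, hi, rfl⟩ := List.getElem_of_mem he
    refine ⟨i + (L.length + 3), ⟨by omega, by omega⟩, ?_⟩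
    simp only [show i + (L.length + 3) ≠ 1 by omega, show i + (L.length + 3) ≠ 2 by omega,
      show ¬ i + (L.length + 3) ≤ L.length + 2 by omega,
      show i + (L.length + 3) ≤ L.length + L'.length + 2 by omega, if_true, if_false,
      Nat.add_sub_cancel]
    rw [List.getD_eq_getElem _ _ hi]
  · rw [show L.length + L'.length + 4 - 1 = L.length + L'.length + 3 by omega]
    simp only [show L.length + L'.length + 3 ≠ 1 by omega,
      show L.length + L'.length + 3 ≠ 2 by omega,
      show ¬ L.length + L'.length + 3 ≤ L.length + 2 by omega,
      show ¬ L.length + L'.length + 3 ≤ L.length + L'.length + 2 by omega, if_true, if_false]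
  · simp only [show L.length + L'.length + 4 ≠ 1 by omega,
      show L.length + L'.length + 4 ≠ 2 by omega,
      show ¬ L.length + L'.length + 4 ≤ L.length + 2 by omega,
      show ¬ L.length + L'.length + 4 ≤ L.length + L'.length + 2 by omega,
      show L.length + L'.length + 4 ≠ L.length + L'.length + 3 by omega, if_false]

/-- `trapFun` is positive at `r₊` for the ratio `p`, hence slightly outside. Larger ratios have
smaller `t`, so one `l` serves the whole unbounded set. -/
theorem exists_trapFun_pos (ha : a ≠ 0) (haM : |a| < M) {p : ℝ} (hp : gammaPlus M a < p) :
    ∃ l > rPlus M a, l < 2 * M ∧ ∀ γ ≥ p, 0 < trapFun M a γ⁻¹ l := by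
  have hlt := rPlus_lt ha haM
  have hpM := mass_lt_rPlus haM
  have hp0 : 0 < p := (gammaPlus_pos haM).trans hp
  have h0 : 0 < trapFun M a p⁻¹ (rPlus M a) := by
    rw [trapFun_rPlus haM]
    exact mul_pos (by linarith) (sub_pos.2 (inv_lt_of_gammaPlus_lt haM hp))
  have hc : Continuous (trapFun M a p⁻¹) := by unfold trapFun cubic; fun_prop
  obtain ⟨δ, hδ, hb⟩ := Metric.eventually_nhds_iff.1 (hc.continuousAt.eventually (lt_mem_nhds h0))
  set l := min (rPlus M a + δ / 2) ((rPlus M a + 2 * M) / 2) with hl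
  have hl1 : rPlus M a < l := lt_min (by linarith) (by linarith)
  refine ⟨l, hl1, (min_le_right _ _).trans_lt (by linarith), fun γ hγ => ?_⟩
  have h1 : 0 < trapFun M a p⁻¹ l := hb (by
    rw [Real.dist_eq, abs_of_pos (by linarith)]
    linarith [min_le_left (rPlus M a + δ / 2) ((rPlus M a + 2 * M) / 2)])
  have h2 : γ⁻¹ ≤ p⁻¹ := inv_anti₀ hp0 hγ
  have h3 : 2 * (l - M) * γ⁻¹ ≤ 2 * (l - M) * p⁻¹ := mul_le_mul_of_nonneg_left h2 (by linarith)
  unfold trapFun at h1 ⊢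
  linarith

theorem exists_super_piece {γ₀ ρ l u : ℝ} (hρ : ρ ∈ Ioo l u)
    (h : 0 < superFun M a γ₀ ρ) : ∃ c > 0, ∃ U ∈ nhds γ₀, ∃ r₁ r₂, l < r₁ ∧ r₁ < r₂ ∧ r₂ < u ∧
      ∀ γ ∈ U, ∀ r ∈ Icc r₁ r₂, c ≤ superFun M a γ r := by
  obtain ⟨r₁, r₂, h1, h2, h3, h4, c, hc, hev⟩ := continuous_tube_Icc continuous_superFun hρ h
  exact ⟨c, hc, _, hev, r₁, r₂, h1, h2.trans h3, h4, fun γ hγ => hγ⟩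

/-- The covering of the frequency ratios, with the radii and the Killing fields attached to it. -/
theorem exists_ranges (ha : a ≠ 0) (haM : |a| < M) :
    ∃ l > rPlus M a, ∃ ε₀ > 0, ∀ ε δ₁ δ₂ : ℝ, 0 < ε → ε < ε₀ → 0 < δ₁ → δ₁ < ε → 0 < δ₂ → δ₂ < ε →
    ∃ (Ns N : ℕ) (I : ℕ → Set ℝ) (x r₁ r₂ : ℕ → ℝ) (c : ℝ), 2 ≤ Ns ∧ Ns + 2 ≤ N ∧ 0 < c ∧
      (∀ n ∈ Icc 1 N, IsOpen (I n) ∧ IsConnected (I n)) ∧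
      (∀ n ∈ Icc 1 N, l ≤ r₁ n ∧ r₁ n < r₂ n ∧ r₂ n ≤ 11 * M) ∧
      0 ∈ I 1 ∧ gammaPlus M a ∈ I 2 ∧
      (∀ n ∈ Icc 3 Ns, I n ⊆ strictSuper M a ε) ∧
      (⋃ n ∈ Icc 1 Ns, I n) = genSuper M a ε ∧
      (⋃ n ∈ Icc (Ns + 1) N, I n) = nonSuper M a δ₁ δ₂ ∧
      ¬ BddBelow (I (N - 1)) ∧ ¬ BddAbove (I N) ∧
      Icc (r₁ 1) (r₂ 1) ⊆ Ioo (4 * M) (6 * M) ∧ I 1 ⊆ Ioo (-ε) ε ∧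
      I 2 ⊆ Ioi (gammaPlus M a - ε) ∧
      (∀ n ∈ Icc 1 Ns, x n = gammaPlus M a ∧
        ∀ γ ∈ I n, ∀ r ∈ Icc (r₁ n) (r₂ n), c ≤ superFun M a γ r) ∧
      (∀ n ∈ Icc (Ns + 1) N, TrapPiece M a c (I n) (x n) (r₁ n) (r₂ n)) ∧
      x (N - 1) = 0 ∧ x N = 0 ∧
      TrapSep M a c 0 (r₁ (N - 1)) (r₂ (N - 1)) ∧ TrapSep M a c 0 (r₁ N) (r₂ N) := by
  have hM := mass_pos haM
  have hγ0 := gammaPlus_pos haM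
  have hlt := rPlus_lt ha haM
  obtain ⟨lS, hlS, hlS5, hS⟩ := exists_superFun_pos ha haM
  obtain ⟨εT, hεT, cT, hcT, xT, r₁T, r₂T, hr₁T, hr₂T, hT⟩ := exists_threshold_piece ha haM
  obtain ⟨τ, hτ, cF, hcF, hF, hF2, hF3⟩ := exists_trapSep_of_le ha haM
  obtain ⟨lM, hlM, hlM2, hQ⟩ := exists_trapFun_pos ha haM
    (show gammaPlus M a < gammaPlus M a + εT / 2 by linarith)
  obtain ⟨cA, hcA, UA, hUA, r₁A, r₂A, hA1, hA2, hA3, hA⟩ := exists_super_piece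
    (show 5 * M ∈ Ioo (4 * M) (6 * M) by constructor <;> linarith)
    (superFun_pos_of_le ha haM le_rfl (by simp))
  obtain ⟨ρB, hρB, hBpos⟩ := hS (gammaPlus M a) ⟨hγ0.le, le_rfl⟩
  obtain ⟨cB, hcB, UB, hUB, r₁B, r₂B, hB1, hB2, hB3, hB⟩ := exists_super_piece
    (show ρB ∈ Ioo lS (6 * M) from ⟨hρB.1, by linarith [hρB.2]⟩) hBpos
  obtain ⟨εA, hεA, hballA⟩ := Metric.mem_nhds_iff.1 hUA
  obtain ⟨εB, hεB, hballB⟩ := Metric.mem_nhds_iff.1 hUB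
  obtain ⟨ε₀, hε₀, hε₀A, hε₀B, hε₀T, hε₀γ, -, -⟩ := exists_pos_le_six hεA hεB (half_pos hεT)
    (half_pos hγ0) hM hM
  obtain ⟨l, hl, hll⟩ : ∃ l > rPlus M a, l ≤ lS ∧ l ≤ r₁T ∧ l ≤ lM ∧ l ≤ 2 * M := by
    refine ⟨min lS (min r₁T (min lM (2 * M))), ?_, ?_⟩
    · simp only [gt_iff_lt, lt_min_iff]
      exact ⟨hlS, hr₁T, hlM, hlt⟩
    · simp only [← le_min_iff, le_refl]
  obtain ⟨hllS, hllT, hllM, hll2⟩ := hll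
  refine ⟨l, hl, ε₀, hε₀, fun ε δ₁ δ₂ hε hεε hδ₁ hδ₁ε hδ₂ hδ₂ε => ?_⟩
  -- the superradiant part
  obtain ⟨cL, hcL, L, hL, hLcov⟩ := exists_list_cover (β := ℝ × ℝ × ℝ)
    (P := fun c J y => y.1 = gammaPlus M a ∧ l ≤ y.2.1 ∧ y.2.1 < y.2.2 ∧ y.2.2 ≤ 11 * M ∧
      ∀ γ ∈ J, ∀ r ∈ Icc y.2.1 y.2.2, c ≤ superFun M a γ r)
    (fun c c' J J' y h hc hJ => ⟨h.1, h.2.1, h.2.2.1, h.2.2.2.1,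
      fun γ hγ r hr => hc.trans (h.2.2.2.2 γ (hJ hγ) r hr)⟩)
    (show ε / 2 < ε by linarith)
    (show gammaPlus M a - ε < gammaPlus M a - ε / 2 by linarith) (by
      intro γ hγ
      obtain ⟨ρ, hρ, hpos⟩ := hS γ ⟨by linarith [hγ.1], by linarith [hγ.2]⟩
      obtain ⟨c, hc, U, hU, r₁, r₂, h1, h2, h3, h4⟩ := exists_super_piece
        (show ρ ∈ Ioo lS (6 * M) from ⟨hρ.1, by linarith [hρ.2]⟩) hpos
      exact ⟨c, hc, U, hU, (gammaPlus M a, r₁, r₂), rfl, by dsimp only; linarith, h2,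
        by dsimp only; linarith, h4⟩)
  -- the non-superradiant part
  set K := max τ⁻¹ (gammaPlus M a + εT) with hK
  have hK1 : τ⁻¹ ≤ K := le_max_left _ _
  have hK2 : gammaPlus M a + εT ≤ K := le_max_right _ _
  obtain ⟨cR, hcR, L', hL', hLcov'⟩ := exists_list_cover (β := ℝ × ℝ × ℝ)
    (P := fun c J y => l ≤ y.2.1 ∧ y.2.2 ≤ 11 * M ∧ TrapPiece M a c J y.1 y.2.1 y.2.2)
    (fun c c' J J' y h hc hJ => ⟨h.1, h.2.1, h.2.2.mono ha hc hJ⟩)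
    (show gammaPlus M a + εT / 2 < gammaPlus M a + 3 * εT / 4 by linarith)
    (show K < K + 1 by linarith) (by
      intro γ hγ
      obtain ⟨c, hc, U, hU, x, r₁, r₂, h1, h2, h3⟩ := exists_middle_piece ha haM
        (show gammaPlus M a < γ by linarith [hγ.1]) hlM (by linarith) (hQ γ (by linarith [hγ.1]))
      exact ⟨c, hc, U, hU, (x, r₁, r₂), by dsimp only; linarith, h2.le, h3⟩)
  obtain ⟨c, hc, hccA, hccB, hccL, hccR, hccT, hccF⟩ := exists_pos_le_six hcA hcB hcL hcR hcT hcF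
  obtain ⟨Ns, N, D, hNs, hN, hD1, hD2, hDL, hLD, hDL', hLD', hDf, hDg⟩ := exists_enumeration
    (β := Set ℝ × ℝ × ℝ × ℝ)
    (Ioo (-ε) ε, gammaPlus M a, r₁A, r₂A)
    (Ioo (gammaPlus M a - ε) (gammaPlus M a + ε), gammaPlus M a, r₁B, r₂B) L
    ((Ioo (gammaPlus M a + δ₂) (gammaPlus M a + εT), xT, r₁T, r₂T) :: L')
    (Iio (-δ₁), 0, 2.05 * M, 11 * M) (Ioi K, 0, 2.05 * M, 11 * M)
  have hsuper : ∀ n ∈ Icc 1 Ns, IsOpen (D n).1 ∧ IsConnected (D n).1 ∧ (D n).1 ⊆ genSuper M a ε ∧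
      (D n).2.1 = gammaPlus M a ∧ l ≤ (D n).2.2.1 ∧ (D n).2.2.1 < (D n).2.2.2 ∧
      (D n).2.2.2 ≤ 11 * M ∧
      ∀ γ ∈ (D n).1, ∀ r ∈ Icc (D n).2.2.1 (D n).2.2.2, c ≤ superFun M a γ r := by
    intro n hn
    obtain rfl | rfl | h3 : n = 1 ∨ n = 2 ∨ 3 ≤ n := by have := hn.1; omega
    · rw [hD1]
      refine ⟨isOpen_Ioo, isConnected_Ioo (by linarith),
        Ioo_subset_Ioo le_rfl (by linarith), rfl, ?_, hA2, ?_, fun γ hγ r hr => ?_⟩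
      · dsimp only; linarith
      · dsimp only; linarith
      · refine hccA.trans (hA γ (hballA ?_) r hr)
        rw [Real.ball_eq_Ioo]
        constructor <;> linarith [hγ.1, hγ.2]
    · rw [hD2]
      refine ⟨isOpen_Ioo, isConnected_Ioo (by linarith),
        Ioo_subset_Ioo (by linarith) le_rfl, rfl, ?_, hB2, ?_, fun γ hγ r hr => ?_⟩
      · dsimp only; linarith
      · dsimp only; linarith
      · refine hccB.trans (hB γ (hballB ?_) r hr)
        rw [Real.ball_eq_Ioo]
        constructor <;> linarith [hγ.1, hγ.2]
    · obtain ⟨h1, h2, h4, h5, h6, h7, h8, h9⟩ := hL (D n) (hDL n ⟨h3, hn.2⟩)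
      exact ⟨h1, h2, h4.trans (Ioo_subset_Ioo (by linarith) (by linarith)), h5, h6, h7, h8,
        fun γ hγ r hr => hccL.trans (h9 γ hγ r hr)⟩
  have hnon : ∀ n ∈ Icc (Ns + 1) N, IsOpen (D n).1 ∧ IsConnected (D n).1 ∧
      (D n).1 ⊆ nonSuper M a δ₁ δ₂ ∧ l ≤ (D n).2.2.1 ∧ (D n).2.2.2 ≤ 11 * M ∧
      TrapPiece M a c (D n).1 (D n).2.1 (D n).2.2.1 (D n).2.2.2 := by
    intro n hn
    have hn2 := hn.2
    obtain rfl | h | h3 : n = N ∨ n = N - 1 ∨ n ≤ N - 2 := by omega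
    · rw [hDg]
      refine ⟨isOpen_Ioi, isConnected_Ioi, fun γ hγ => Or.inr ?_, by dsimp only; linarith, le_rfl,
        le_rfl, hγ0.le, by dsimp only; linarith, fun r hr => hccF.trans (hF3 r hr), fun γ hγ => ?_⟩
      · rw [mem_Ioi] at hγ ⊢; linarith
      · have hγK : K < γ := hγ
        exact (hF _ (inv_le_of_inv_le₀ hτ (by linarith))).mono hccF ha
    · rw [h, hDf]
      refine ⟨isOpen_Iio, isConnected_Iio, fun γ hγ => Or.inl hγ, by dsimp only; linarith, le_rfl,
        le_rfl, hγ0.le, by dsimp only; linarith, fun r hr => hccF.trans (hF3 r hr), fun γ hγ => ?_⟩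
      have hγδ : γ < -δ₁ := hγ
      exact (hF _ ((inv_nonpos.2 (by linarith)).trans hτ.le)).mono hccF ha
    · rcases List.mem_cons.1 (hDL' n ⟨hn.1, h3⟩) with h | h
      · rw [h]
        refine ⟨isOpen_Ioo, isConnected_Ioo (by linarith), fun γ hγ => Or.inr hγ.1, hllT, hr₂T.le,
          hT.mono ha hccT (Ioo_subset_Ioo (by linarith) le_rfl)⟩
      · obtain ⟨h1, h2, h4, h5, h6, h7⟩ := hL' (D n) h
        refine ⟨h1, h2, fun γ hγ => Or.inr ?_, h5, h6, h7.mono ha hccR Subset.rfl⟩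
        have := (h4 hγ).1
        rw [mem_Ioi]; linarith
  refine ⟨Ns, N, fun n => (D n).1, fun n => (D n).2.1, fun n => (D n).2.2.1, fun n => (D n).2.2.2, c,
    hNs, hN, hc, fun n hn => ?_, fun n hn => ?_, ?_, ?_, fun n hn => ?_, ?_, ?_, ?_, ?_, ?_, ?_, ?_,
    fun n hn => ?_, fun n hn => (hnon n hn).2.2.2.2.2, ?_, ?_, ?_, ?_⟩
  · rcases le_or_gt n Ns with h | h
    · obtain ⟨h1, h2, -⟩ := hsuper n ⟨hn.1, h⟩
      exact ⟨h1, h2⟩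
    · obtain ⟨h1, h2, -⟩ := hnon n ⟨h, hn.2⟩
      exact ⟨h1, h2⟩
  · rcases le_or_gt n Ns with h | h
    · obtain ⟨-, -, -, -, h1, h2, h3, -⟩ := hsuper n ⟨hn.1, h⟩
      exact ⟨h1, h2, h3⟩
    · obtain ⟨-, -, -, h1, h2, h3⟩ := hnon n ⟨h, hn.2⟩
      exact ⟨h1, by linarith [h3.2.2.1], h2⟩
  · simp only [hD1]; constructor <;> linarith
  · simp only [hD2]; constructor <;> linarith
  · exact (hL (D n) (hDL n hn)).2.2.1
  · refine Subset.antisymm (iUnion₂_subset fun n hn => (hsuper n hn).2.2.1) fun γ hγ => ?_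
    rw [mem_iUnion₂]
    rcases lt_or_ge γ ε with h | h
    · exact ⟨1, ⟨le_rfl, by omega⟩, by dsimp only; rw [hD1]; exact ⟨hγ.1, h⟩⟩
    rcases lt_or_ge (gammaPlus M a - ε) γ with h' | h'
    · exact ⟨2, ⟨by omega, hNs⟩, by dsimp only; rw [hD2]; exact ⟨h', hγ.2⟩⟩
    obtain ⟨e, he, hγe⟩ := hLcov γ ⟨h, h'⟩
    obtain ⟨n, hn, rfl⟩ := hLD e he
    exact ⟨n, ⟨by have := hn.1; omega, hn.2⟩, hγe⟩
  · refine Subset.antisymm (iUnion₂_subset fun n hn => (hnon n hn).2.2.1) fun γ hγ => ?_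
    rw [mem_iUnion₂]
    rcases hγ with hγ | hγ
    · exact ⟨N - 1, ⟨by omega, by omega⟩, by dsimp only; rw [hDf]; exact hγ⟩
    rcases lt_or_ge K γ with h | h
    · exact ⟨N, ⟨by omega, le_rfl⟩, by dsimp only; rw [hDg]; exact h⟩
    rcases lt_or_ge γ (gammaPlus M a + εT) with h' | h'
    · obtain ⟨n, hn, hDn⟩ := hLD' _ (List.mem_cons_self)
      exact ⟨n, ⟨hn.1, hn.2.trans (by omega)⟩, by dsimp only; rw [hDn]; exact ⟨hγ, h'⟩⟩
    obtain ⟨e, he, hγe⟩ := hLcov' γ ⟨by linarith, h⟩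
    obtain ⟨n, hn, rfl⟩ := hLD' e (List.mem_cons_of_mem _ he)
    exact ⟨n, ⟨hn.1, hn.2.trans (by omega)⟩, hγe⟩
  · simp only [hDf]; exact not_bddBelow_Iio _
  · simp only [hDg]; exact not_bddAbove_Ioi _
  · simp only [hD1]; exact fun r hr => ⟨hA1.trans_le hr.1, hr.2.trans_lt hA3⟩
  · simp only [hD1]; exact Subset.rfl
  · simp only [hD2]; exact fun γ hγ => hγ.1
  · obtain ⟨-, -, -, h1, -, -, -, h2⟩ := hsuper n hn
    exact ⟨h1, h2⟩
  · simp only [hDf]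
  · simp only [hDg]
  · simp only [hDf]; exact (hF 0 hτ.le).mono hccF ha
  · simp only [hDg]; exact (hF 0 hτ.le).mono hccF ha

/-! ### Transfer to the frequency triples -/

theorem Admissible.pos {ω Λ : ℝ} {m : ℤ} (h : Admissible a ω m Λ) (hm : m ≠ 0) : 0 < Λ := by
  have h1 : 0 < |(m : ℝ)| := abs_pos.2 (by exact_mod_cast hm)
  have h2 : 0 < |(m : ℝ)| * (|(m : ℝ)| + 1) := by positivity
  exact h2.trans_le h.1

theorem RatioIn.exists_eq (ha : a ≠ 0) {J : Set ℝ} {ω : ℝ} {m : ℤ} (h : RatioIn a J ω m) :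
    ∃ γ ∈ J, ω = γ * (a * m) := by
  have hm : (m : ℝ) ≠ 0 := by exact_mod_cast h.1
  exact ⟨_, h.2, (div_mul_cancel₀ ω (mul_ne_zero ha hm)).symm⟩

theorem V0'_eq_zero_of_isLocalMax {ω Λ r : ℝ} {m : ℤ} (h : IsLocalMax (V0 M a ω m Λ) r) :
    V0' M a ω m Λ r = 0 := by
  rw [V0', rStarDeriv, h.deriv_eq_zero, mul_zero]

/-- The variable `t = a m / ω` brings in `m = 0` as the regular value `t = 0`, which is no inverse
of a ratio and is supplied by `hz`. -/
theorem exists_trapSep_of_inRange (ha : a ≠ 0) {I : ℕ → Set ℝ} {N n : ℕ} {ω c r₁ r₂ : ℝ} {m : ℤ}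
    (h : InRange a I N n ω m) (h0 : (0 : ℝ) ∉ I n) (hI : ∀ γ ∈ I n, TrapSep M a c γ⁻¹ r₁ r₂)
    (hz : n + 1 = N ∨ n = N → TrapSep M a c 0 r₁ r₂) :
    ω ≠ 0 ∧ ∃ t, a * m = t * ω ∧ TrapSep M a c t r₁ r₂ := by
  rcases h with h | ⟨hn, hm, hω⟩ | ⟨hn, hm, hω⟩
  · obtain ⟨γ, hγ, rfl⟩ := h.exists_eq ha
    have hm : (m : ℝ) ≠ 0 := by exact_mod_cast h.1
    have hγ0 : γ ≠ 0 := fun h => h0 (h ▸ hγ)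
    exact ⟨by positivity, γ⁻¹, by field_simp, hI γ hγ⟩
  · exact ⟨right_ne_zero_of_mul hω.ne, 0, by simp [hm], hz (Or.inl hn)⟩
  · exact ⟨right_ne_zero_of_mul hω.ne', 0, by simp [hm], hz (Or.inr hn)⟩

theorem le_of_isTrappingDegeneration (ha : a ≠ 0) (haM : |a| < M)
    {ωhigh εwidth α btrap κ d r₁ r₂ ω Λ : ℝ} {m : ℤ} {χ : ℝ → ℝ → ℤ → ℝ → ℝ}
    (hχ : IsTrappingDegeneration M a ωhigh εwidth α btrap κ χ) (hκ : 0 < κ) (hd : 0 < d)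
    (hadm : Admissible a ω m Λ)
    (hcrit : ∀ p, IsInteriorMax M a ω m Λ p → |V0 M a ω m Λ p - ω ^ 2| ≤ btrap * ω ^ 2 →
      r₁ + d ≤ p ∧ p ≤ r₂ - d) {r : ℝ} (hr : rPlus M a < r) (hr' : r ≤ r₁ ∨ r₂ ≤ r) :
    min (1 / 2) (κ / 2 * d ^ 2) ≤ χ r ω m Λ := by
  by_cases htr : TrappedRange M a ωhigh εwidth α btrap ω m Λ
  · obtain ⟨p, hp, hV⟩ := htr.2
    obtain ⟨h1, h2⟩ := hcrit p hp hV
    have h3 := le_of_convex_well haM ha hκ (hχ.smooth ω m Λ htr) hp.1 (hχ.vanish p ω m Λ htr hp)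
      (fun s hs => hχ.nonneg s ω m Λ hs hadm) (fun s hs h => hχ.convex s ω m Λ hs htr h)
      (hχ.single_well ω m Λ htr) hr
    refine le_trans (min_le_min le_rfl ?_) h3
    have h4 : d ^ 2 ≤ (r - p) ^ 2 := by
      rw [sq_le_sq, abs_of_pos hd, le_abs]
      rcases hr' with h | h
      · right; linarith
      · left; linarith
    gcongr
  · rw [hχ.eq_one r ω m Λ hr hadm htr]
    exact (min_le_left _ _).trans (by norm_num)

end Kerr

end

/-! ### Choice of constants and assembly of the proposition -/

set_option maxHeartbeats 1000000 in
open Kerr in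
theorem propositionA4 (M a : ℝ) (ha : a ≠ 0) (haM : |a| < M) :
    -- `r_pot` is sufficiently close to `r₊`, `R_pot` sufficiently large, `ε` sufficiently small
    ∃ r₀ R₀ : ℝ, rPlus M a < r₀ ∧ r₀ ≤ 2.01 * M ∧ 5 * M ≤ R₀ ∧
    ∀ Rpot : ℝ, R₀ < Rpot → ∃ ε₀ : ℝ, 0 < ε₀ ∧
    ∀ ε δ₁ δ₂ rpot : ℝ, 0 < ε → ε < ε₀ → 0 < δ₁ → δ₁ < ε → 0 < δ₂ → δ₂ < ε →
      rPlus M a < rpot → rpot < r₀ →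
    ∃ (Ns N : ℕ) (I : ℕ → Set ℝ) (α r₁ r₂ : ℕ → ℝ) (b b' c : ℝ),
      2 ≤ Ns ∧ Ns + 2 ≤ N ∧ 0 < b ∧ 0 < b' ∧ 0 < c ∧
      -- the covering
      (∀ n ∈ Icc 1 N, IsOpen (I n) ∧ IsConnected (I n)) ∧
      (⋃ n ∈ Icc 1 N, I n) = univ ∧
      (∀ n ∈ Icc 1 N, rpot < r₁ n ∧ r₁ n < r₂ n ∧ r₂ n < Rpot) ∧
      0 ∈ I 1 ∧ gammaPlus M a ∈ I 2 ∧
      (∀ n ∈ Icc 3 Ns, I n ⊆ strictSuper M a ε) ∧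
      (⋃ n ∈ Icc 1 Ns, I n) = genSuper M a ε ∧
      (⋃ n ∈ Icc (Ns + 1) N, I n) = nonSuper M a δ₁ δ₂ ∧
      ¬ BddBelow (I (N - 1)) ∧ ¬ BddAbove (I N) ∧
      -- the generalised superradiant ranges
      (∀ n ∈ Icc 1 Ns, α n = a / (2 * M * rPlus M a)) ∧
      (∀ n ∈ Icc 1 Ns, ∀ (ω : ℝ) (m : ℤ) (Λ : ℝ), Admissible a ω m Λ → RatioIn a (I n) ω m →
        {r | rPlus M a < r ∧ V0 M a ω m Λ r - ω ^ 2 < b * ω ^ 2 ∧ 0 < V0' M a ω m Λ r}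
          ⊆ Ioo (rPlus M a) (r₁ n) ∧
        {r | rPlus M a < r ∧ V0 M a ω m Λ r - ω ^ 2 < b * ω ^ 2 ∧ V0' M a ω m Λ r < 0}
          ⊆ Ioi (r₂ n) ∧
        Icc (r₁ n) (r₂ n) ⊆ {r | rPlus M a < r ∧ b * ω ^ 2 ≤ V0 M a ω m Λ r - ω ^ 2} ∧
        {r | rPlus M a < r ∧ r < 2 * Rpot ∧ |V0 M a ω m Λ r - ω ^ 2| ≤ b * ω ^ 2 ∧
          |V0' M a ω m Λ r| ≤ b' * Delta M a r * (r ^ 2)⁻¹ * ω ^ 2} = ∅ ∧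
        (∀ r ∈ Ioc (rPlus M a) rpot,
          c * (Delta M a r * (r ^ 2)⁻¹ * (Λ + ω ^ 2)) ≤ V0' M a ω m Λ r)) ∧
      -- all ranges other than the first
      (∀ n ∈ Icc 2 N, ∀ (ω : ℝ) (m : ℤ) (Λ : ℝ), Admissible a ω m Λ → RatioIn a (I n) ω m →
        ∀ r ∈ Icc (rPlus M a) (1.2 * Rpot), ω ^ 2 ≤ V0 M a ω m Λ r →
          c * (Delta M a r * Λ) ≤ ω ^ 2 + V0 M a ω m Λ r) ∧
      -- the first range
      Icc (r₁ 1) (r₂ 1) ⊆ Ioo (4 * M) (6 * M) ∧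
      (∀ (ω : ℝ) (m : ℤ) (Λ : ℝ), Admissible a ω m Λ → RatioIn a (I 1) ω m →
        (∀ r ∈ Ioc (rPlus M a) (2.1 * M),
          c * (Delta M a r * (r ^ 2)⁻¹ * (Λ + ω ^ 2)) ≤ V0' M a ω m Λ r) ∧
        (∀ r ∈ Ici (2.01 * M), c * ((r ^ 2)⁻¹ * (Λ + ω ^ 2)) ≤ V0 M a ω m Λ r) ∧
        (∀ r ∈ Icc (2.01 * M) (1.2 * Rpot), 1 / 2 * ω ^ 2 < V0 M a ω m Λ r)) ∧
      -- the non-superradiant ranges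
      (∀ n ∈ Icc (Ns + 1) N, ∀ (ω : ℝ) (m : ℤ) (Λ : ℝ), Admissible a ω m Λ →
        InRange a I N n ω m →
        {r | rPlus M a < r ∧ |V0 M a ω m Λ r - ω ^ 2| < b * ω ^ 2 ∧ 0 < V0' M a ω m Λ r}
          ⊆ Ioo (rPlus M a) (r₂ n) ∧
        {r | rPlus M a < r ∧ |V0 M a ω m Λ r - ω ^ 2| < b * ω ^ 2 ∧ V0' M a ω m Λ r < 0}
          ⊆ Ioi (r₁ n) ∧
        {r | rPlus M a < r ∧ r < 2 * Rpot ∧ |V0 M a ω m Λ r - ω ^ 2| < b * ω ^ 2 ∧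
          |V0' M a ω m Λ r| < b' * Delta M a r * (r ^ 2)⁻¹ * ω ^ 2} ⊆ Ioo (r₁ n) (r₂ n)) ∧
      (∀ n ∈ Icc (Ns + 1) N, 0 ≤ α n * (2 * M * rPlus M a) / a ∧
        α n * (2 * M * rPlus M a) / a ≤ 1) ∧
      (∃ β : ℝ, β < 0 ∧ ∀ n ∈ Icc (Ns + 1) N, ∀ r ∈ Ioo (r₁ n) (r₂ n), ∀ θ ∈ Icc 0 Real.pi,
        metric M a r θ (T + α n • Omega1) (T + α n • Omega1) ≤ β) ∧
      α (N - 1) = 0 ∧ α N = 0 ∧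
      -- the trapping degeneration, for `b_trap` sufficiently small
      (∃ b₀ : ℝ, 0 < b₀ ∧ ∀ btrap : ℝ, 0 < btrap → btrap ≤ b₀ →
        ∀ ωhigh εwidth α' κ : ℝ, 0 < ωhigh → 0 < εwidth → 0 < α' → 0 < κ →
        ∃ c' : ℝ, 0 < c' ∧
        ∀ χ : ℝ → ℝ → ℤ → ℝ → ℝ, IsTrappingDegeneration M a ωhigh εwidth α' btrap κ χ →
          (∀ n ∈ Icc 1 Ns, ∀ (ω : ℝ) (m : ℤ) (Λ : ℝ), Admissible a ω m Λ → RatioIn a (I n) ω m →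
            ∀ r, rPlus M a < r → χ r ω m Λ = 1) ∧
          (∀ n ∈ Icc (Ns + 1) N, ∀ (ω : ℝ) (m : ℤ) (Λ : ℝ), Admissible a ω m Λ →
            InRange a I N n ω m →
            ∀ r ∈ Ioc (rPlus M a) (r₁ n) ∪ Ici (r₂ n), c' ≤ χ r ω m Λ)) := by
  have hM := mass_pos haM
  have hpM := mass_lt_rPlus haM
  have hp2 := rPlus_lt ha haM
  have hγ0 := gammaPlus_pos haM
  have ha2 : 0 < a ^ 2 := by positivity
  obtain ⟨ρP, hρP, εP, hεP, cP, hcP, hslope⟩ := exists_le_potSlope ha haM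
  obtain ⟨l, hl, εR, hεR, hranges⟩ := exists_ranges ha haM
  -- `ρP` gives the slope bound up to `r_pot`, `l` puts every `r₁ n` beyond `r_pot`, and `12M`
  -- exceeds the bound `11M` on every `r₂ n`.
  refine ⟨min ρP (min l (2.01 * M)), 12 * M, lt_min hρP (lt_min hl (by linarith)),
    (min_le_right _ _).trans (min_le_right _ _), by linarith, fun Rpot hRpot => ?_⟩
  have hR0 : 0 < Rpot := by linarith
  obtain ⟨ε₄, hε₄, c₄, hc₄, hsmall⟩ := small_ratio_properties ha haM Rpot
  -- The quotient bound keeps the concavity condition `Λ (r₊ - M) + 2 M k ω ≥ 0` for `γ > -ε`; the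
  -- bound by `γ₊ / 2` keeps `I 2` away from `0`.
  obtain ⟨ε₀, hε₀, hε₀P, hε₀R, hε₀4, hε₀C, hε₀γ, -⟩ := exists_pos_le_six hεP hεR hε₄
    (show 0 < (rPlus M a - M) / (2 * M * a ^ 2) from div_pos (by linarith) (by positivity))
    (half_pos hγ0) hM
  refine ⟨ε₀, hε₀, fun ε δ₁ δ₂ rpot hε hεε hδ₁ hδ₁ε hδ₂ hδ₂ε hrp hrp0 => ?_⟩
  simp only [lt_min_iff] at hrp0
  obtain ⟨Ns, N, I, x, r₁, r₂, c, hNs, hN, hc, hopen, hr12, h01, hg2, hstrict, hgen, hnons, hbelow,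
    habove, hI1r, hI1, hI2, hsup, htrap, hxf, hxg, htf, htg⟩ :=
    hranges ε δ₁ δ₂ hε (by linarith) hδ₁ hδ₁ε hδ₂ hδ₂ε
  -- the constants
  set C := gammaPlus M a + ε with hC
  have hC0 : 0 ≤ C := by positivity
  obtain ⟨b₁, hb₁, hsuperP⟩ := super_properties ha haM hcP
    (show 0 < c / ((11 * M) ^ 2 + a ^ 2) ^ 2 by positivity) hC0 hR0
  obtain ⟨b₂, hb₂, hnonP⟩ := nonsuper_properties ha haM hc (show 10 * M ≤ 2 * Rpot by linarith)
  set b := min b₁ b₂ with hb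
  have hb0 : 0 < b := lt_min hb₁ hb₂
  obtain ⟨c₂, hc₂, hw⟩ := exists_weighted_le (a := a) (ρ := ρP) haM hcP hC0
  -- A lower bound for `|γ|` on all ranges but the first: `ε / 2` on the strictly superradiant ones,
  -- `γ₊ / 2` on `I 2` and above the threshold, `δ₁` on negative ratios.
  obtain ⟨γ₀, hγ₀, hγ₀ε, hγ₀δ, hγ₀γ, -, -, -⟩ := exists_pos_le_six (half_pos hε) hδ₁ (half_pos hγ0)
    hM hM hM
  obtain ⟨c₃, hc₃, hthird⟩ := exists_le_sq_add_pot ha haM hγ₀ (show 0 < 1.2 * Rpot by linarith)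
  set c₀ := min c₂ (min c₃ c₄) with hc₀
  have hc₀₂ : c₀ ≤ c₂ := min_le_left _ _
  have hc₀₃ : c₀ ≤ c₃ := (min_le_right _ _).trans (min_le_left _ _)
  have hc₀₄ : c₀ ≤ c₄ := (min_le_right _ _).trans (min_le_right _ _)
  have hc₀0 : 0 < c₀ := lt_min hc₂ (lt_min hc₃ hc₄)
  -- the superradiant triples
  have hIgen : ∀ n ∈ Icc 1 Ns, ∀ γ ∈ I n, -ε < γ ∧ γ < gammaPlus M a + ε := fun n hn γ hγ => by
    have : γ ∈ genSuper M a ε := by rw [← hgen]; exact mem_biUnion hn hγ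
    exact this
  have hInon : ∀ n ∈ Icc (Ns + 1) N, ∀ γ ∈ I n, γ < -δ₁ ∨ gammaPlus M a + δ₂ < γ :=
    fun n hn γ hγ => by
      have : γ ∈ nonSuper M a δ₁ δ₂ := by rw [← hnons]; exact mem_biUnion hn hγ
      exact this
  have hsuper : ∀ n ∈ Icc 1 Ns, ∀ (ω : ℝ) (m : ℤ) (Λ : ℝ), Admissible a ω m Λ →
      RatioIn a (I n) ω m →
      (∀ r, rPlus M a < r → pot M a (a * m) ω Λ r - ω ^ 2 < b * ω ^ 2 →
        0 < pot' M a (a * m) ω Λ r → r < r₁ n) ∧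
      (∀ r, rPlus M a < r → pot M a (a * m) ω Λ r - ω ^ 2 < b * ω ^ 2 →
        pot' M a (a * m) ω Λ r < 0 → r₂ n < r) ∧
      (∀ r ∈ Icc (r₁ n) (r₂ n), b * ω ^ 2 ≤ pot M a (a * m) ω Λ r - ω ^ 2) ∧
      (∀ r, rPlus M a < r → r < 2 * Rpot → |pot M a (a * m) ω Λ r - ω ^ 2| ≤ b * ω ^ 2 →
        b * Delta M a r * (r ^ 2)⁻¹ * ω ^ 2 < |pot' M a (a * m) ω Λ r|) ∧
      (∀ r, rPlus M a < r → pot' M a (a * m) ω Λ r = 0 →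
        b * ω ^ 2 < pot M a (a * m) ω Λ r - ω ^ 2) := by
    intro n hn ω m Λ hadm hrat
    obtain ⟨γ, hγ, hω⟩ := hrat.exists_eq ha
    have hΛ := hadm.pos hrat.1
    have hk := hadm.sq_le
    have hkω := hadm.abs_le
    obtain ⟨hγ1, hγ2⟩ := hIgen n hn γ hγ
    have hωC : ω ^ 2 ≤ C * Λ := by
      rw [hω] at hkω ⊢
      exact sq_ratio_le hkω (abs_le.2 ⟨by linarith, hγ2.le⟩)
    obtain ⟨hl1, hl2, hl3⟩ := hr12 n ⟨hn.1, by have := hn.2; omega⟩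
    exact hsuperP b b hb0 (min_le_left _ _) hb0 (min_le_left _ _) (r₁ n) (r₂ n) (a * m) ω Λ
      (by linarith) hl2 (by linarith) hΛ hωC
      (by
        have h1 : ε * (2 * M * a ^ 2) ≤ rPlus M a - M := by
          rw [← le_div_iff₀ (by positivity)]; linarith
        have h2 : -(ε * (a * m) ^ 2) ≤ γ * (a * m) ^ 2 := by nlinarith [sq_nonneg (a * (m : ℝ))]
        have h3 : ε * (a * m) ^ 2 ≤ ε * (a ^ 2 * Λ) := by gcongr
        have h4 : M * (-(ε * (a ^ 2 * Λ))) ≤ M * (γ * (a * m) ^ 2) :=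
          mul_le_mul_of_nonneg_left (by linarith) hM.le
        have h5 := mul_le_mul_of_nonneg_right h1 hΛ.le
        rw [hω]
        linarith)
      (by
        rw [hω]
        exact hslope γ (by linarith) _ ⟨le_rfl, hρP.le⟩ _ _ hk)
      (fun r hr => by
        rw [hω]
        have := (hsup n hn).2 γ hγ r hr
        exact le_pot_sub ha hc.le hΛ.le hk (by linarith [hr.1, rPlus_pos haM])
          (by linarith [hr.2]) this)
  -- the non-superradiant triples
  have hnon : ∀ n ∈ Icc (Ns + 1) N, ∀ (ω : ℝ) (m : ℤ) (Λ : ℝ), Admissible a ω m Λ →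
      InRange a I N n ω m → ω ≠ 0 ∧
      ∀ r, rPlus M a < r → |V0 M a ω m Λ r - ω ^ 2| < b * ω ^ 2 →
        (r ≤ r₁ n + c → b * Delta M a r * (r ^ 2)⁻¹ * ω ^ 2 ≤ V0' M a ω m Λ r) ∧
        (r₂ n - c ≤ r → V0' M a ω m Λ r < 0 ∧
          (r ≤ 2 * Rpot → V0' M a ω m Λ r ≤ -(b * Delta M a r * (r ^ 2)⁻¹ * ω ^ 2))) := by
    intro n hn ω m Λ hadm hin
    obtain ⟨hω, t, ht, hsep⟩ := exists_trapSep_of_inRange ha hin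
      (fun h => by rcases hInon n hn 0 h with h | h <;> linarith) (htrap n hn).2.2.2.2
      (by
        rintro (h | h)
        · rw [show n = N - 1 by omega]; exact htf
        · rw [h]; exact htg)
    have hk := hadm.sq_le
    have hkω := hadm.abs_le
    obtain ⟨-, -, hl3⟩ := hr12 n ⟨by have := hn.1; omega, hn.2⟩
    refine ⟨hω, fun r hr hV => ?_⟩
    rw [V0_eq_pot] at hV
    simp only [V0'_eq_pot' ha]
    rw [ht] at hk hkω hV ⊢
    exact hnonP b b (min_le_right _ _) (min_le_right _ _) t (r₁ n) (r₂ n) ω Λ hsep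
      (by linarith [(htrap n hn).2.2.1]) hω hk hkω r hr hV
  have hpos : ∀ ω r : ℝ, ω ≠ 0 → rPlus M a < r → 0 < b * Delta M a r * (r ^ 2)⁻¹ * ω ^ 2 :=
    fun ω r hω hr => by
      have := Delta_pos haM hr
      have := (rPlus_pos haM).trans hr
      positivity
  -- The witness `b / 2` for the bound on `btrap` turns the non-strict trapping condition into the
  -- strict one used by `hnon`.
  refine ⟨Ns, N, I, fun n => a * x n, r₁, r₂, b, b, c₀, hNs, hN, hb0, hb0, hc₀0, hopen, ?_,
    fun n hn => ?_, h01, hg2, hstrict, hgen, hnons, hbelow, habove, fun n hn => ?_,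
    fun n hn ω m Λ hadm hrat => ?_, fun n hn ω m Λ hadm hrat r hr hV => ?_, hI1r,
    fun ω m Λ hadm hrat => ?_, fun n hn ω m Λ hadm hin => ?_, fun n hn => ?_, ?_, ?_, ?_,
    b / 2, half_pos hb0, fun btrap hbt hbt' ωhigh εwidth α' κ hωh hεw hα' hκ => ?_⟩
  · refine eq_univ_of_forall fun γ => ?_
    rw [mem_iUnion₂]
    rcases lt_or_ge γ (-δ₁) with h | h
    · have : γ ∈ ⋃ n ∈ Icc (Ns + 1) N, I n := by rw [hnons]; exact Or.inl h
      obtain ⟨n, hn, hγ⟩ := mem_iUnion₂.1 this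
      exact ⟨n, ⟨by have := hn.1; omega, hn.2⟩, hγ⟩
    rcases lt_or_ge (gammaPlus M a + δ₂) γ with h' | h'
    · have : γ ∈ ⋃ n ∈ Icc (Ns + 1) N, I n := by rw [hnons]; exact Or.inr h'
      obtain ⟨n, hn, hγ⟩ := mem_iUnion₂.1 this
      exact ⟨n, ⟨by have := hn.1; omega, hn.2⟩, hγ⟩
    · have : γ ∈ ⋃ n ∈ Icc 1 Ns, I n := by
        rw [hgen]; constructor <;> linarith
      obtain ⟨n, hn, hγ⟩ := mem_iUnion₂.1 this
      exact ⟨n, ⟨hn.1, hn.2.trans (by omega)⟩, hγ⟩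
  · obtain ⟨h1, h2, h3⟩ := hr12 n hn
    exact ⟨by linarith [hrp0.2.1], h2, by linarith⟩
  · dsimp only
    rw [(hsup n hn).1, gammaPlus, div_eq_mul_inv]
  · obtain ⟨h1, h2, h3, h4, -⟩ := hsuper n hn ω m Λ hadm hrat
    simp only [V0'_eq_pot' ha, V0_eq_pot]
    obtain ⟨hl1, hl2, hl3⟩ := hr12 n ⟨hn.1, by have := hn.2; omega⟩
    refine ⟨fun r hr => ⟨hr.1, h1 r hr.1 hr.2.1 hr.2.2⟩, fun r hr => h2 r hr.1 hr.2.1 hr.2.2,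
      fun r hr => ⟨by linarith [hr.1], h3 r hr⟩, ?_, fun r hr => ?_⟩
    · rw [eq_empty_iff_forall_notMem]
      rintro r ⟨hr1, hr2, hr3, hr4⟩
      exact absurd hr4 (not_le.2 (h4 r hr1 hr2 hr3))
    · obtain ⟨γ, hγ, hω⟩ := hrat.exists_eq ha
      have hΛ := hadm.pos hrat.1
      obtain ⟨hγ1, hγ2⟩ := hIgen n hn γ hγ
      have hkω := hadm.abs_le
      have hD := Delta_pos haM hr.1
      have hr0 := (rPlus_pos haM).trans hr.1
      rw [hω] at hkω ⊢
      refine le_trans ?_ (hw Λ (γ * (a * m)) r _ hΛ.le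
        (sq_ratio_le hkω (abs_le.2 ⟨by linarith, hγ2.le⟩)) hr.1 (by linarith [hr.2, hrp0.1])
        (hslope γ (by linarith) r ⟨hr.1.le, by linarith [hr.2, hrp0.1]⟩ _ _ hadm.sq_le))
      gcongr
  · obtain ⟨γ, hγ, hω⟩ := hrat.exists_eq ha
    have hΛ := hadm.pos hrat.1
    have hγγ : γ₀ ≤ |γ| := by
      rw [le_abs]
      rcases le_or_gt n Ns with h | h
      · left
        obtain rfl | h3 : n = 2 ∨ 3 ≤ n := by have := hn.1; omega
        · have := mem_Ioi.1 (hI2 hγ)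
          linarith
        · have := (hstrict n ⟨h3, h⟩ hγ).1
          linarith
      · rcases hInon n ⟨h, hn.2⟩ γ hγ with h | h
        · right; linarith
        · left; linarith
    rw [V0_eq_pot] at hV ⊢
    rw [hω] at hV ⊢
    refine le_trans ?_ (hthird γ (a * m) Λ r hγγ hΛ.le hr hV)
    have := Delta_nonneg haM hr.1
    gcongr
  · obtain ⟨γ, hγ, hω⟩ := hrat.exists_eq ha
    have hΛ := hadm.pos hrat.1
    have hkω := hadm.abs_le
    simp only [V0'_eq_pot' ha, V0_eq_pot]
    rw [hω] at hkω ⊢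
    obtain ⟨h1, h2, h3⟩ := hsmall γ (a * m) Λ
      (abs_lt.2 ⟨by linarith [(hI1 hγ).1], by linarith [(hI1 hγ).2]⟩) hΛ hadm.sq_le hkω
    refine ⟨fun r hr => le_trans ?_ (h1 r hr), fun r hr => le_trans ?_ (h2 r hr), h3⟩
    · have hD := Delta_pos haM hr.1
      have hr0 := (rPlus_pos haM).trans hr.1
      gcongr
    · gcongr
  · obtain ⟨hω, hn'⟩ := hnon n hn ω m Λ hadm hin
    have hsep := (htrap n hn).2.2.1
    refine ⟨fun r ⟨hr1, hr2, hr3⟩ => ⟨hr1, ?_⟩, fun r ⟨hr1, hr2, hr3⟩ => ?_,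
      fun r ⟨hr1, hr2, hr3, hr4⟩ => ⟨?_, ?_⟩⟩
    · by_contra! h
      linarith [((hn' r hr1 hr2).2 (by linarith)).1]
    · rw [mem_Ioi]
      by_contra! h
      linarith [(hn' r hr1 hr2).1 (by linarith), hpos ω r hω hr1]
    · by_contra! h
      have h1 := (hn' r hr1 hr3).1 (by linarith)
      linarith [le_abs_self (V0' M a ω m Λ r)]
    · by_contra! h
      have h1 := ((hn' r hr1 hr3).2 (by linarith)).2 hr2.le
      linarith [neg_le_abs (V0' M a ω m Λ r)]
  · have h1 : a * x n * (2 * M * rPlus M a) / a = x n * (2 * M * rPlus M a) := by field_simp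
    have hpp := rPlus_pos haM
    have h2 : 0 < 2 * M * rPlus M a := by positivity
    have h3 := (htrap n hn).1
    have h4 := (htrap n hn).2.1
    dsimp only
    rw [h1]
    refine ⟨by positivity, ?_⟩
    rw [gammaPlus] at h4
    calc x n * (2 * M * rPlus M a) ≤ (2 * M * rPlus M a)⁻¹ * (2 * M * rPlus M a) := by gcongr
      _ = 1 := inv_mul_cancel₀ h2.ne'
  · refine ⟨-(c / ((11 * M) ^ 2 + a ^ 2)), neg_lt_zero.2 (by positivity), fun n hn r hr θ hθ => ?_⟩
    obtain ⟨h1, h2, h3, h4, -⟩ := htrap n hn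
    obtain ⟨hl1, -, hl3⟩ := hr12 n ⟨by have := hn.1; omega, hn.2⟩
    exact metric_le haM h1 h2 (by linarith [hr.1]) (by linarith [hr.2]) hc.le (h4 r hr)
  · dsimp only; rw [hxf, mul_zero]
  · dsimp only; rw [hxg, mul_zero]
  -- `c` is the margin in `TrapSep`: a trapped maximum lies in `[r₁ n + c, r₂ n - c]`, at distance
  -- at least `c` from the radii considered.
  · refine ⟨min (1 / 2) (κ / 2 * c ^ 2), lt_min (by norm_num) (by positivity), fun χ hχ => ⟨?_, ?_⟩⟩
    · intro n hn ω m Λ hadm hrat r hr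
      refine hχ.eq_one r ω m Λ hr hadm ?_
      rintro ⟨-, p, hp, hV⟩
      obtain ⟨-, -, -, -, h5⟩ := hsuper n hn ω m Λ hadm hrat
      have h6 := V0'_eq_zero_of_isLocalMax hp.2
      rw [V0'_eq_pot' ha] at h6
      have h7 := h5 p hp.1 h6
      rw [V0_eq_pot] at hV
      have h8 : btrap * ω ^ 2 ≤ b * ω ^ 2 := by gcongr; linarith
      linarith [le_abs_self (pot M a (a * m) ω Λ p - ω ^ 2)]
    · intro n hn ω m Λ hadm hin r hr
      obtain ⟨hω, hn'⟩ := hnon n hn ω m Λ hadm hin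
      have hsep := (htrap n hn).2.2.1
      obtain ⟨hl1, hl2, -⟩ := hr12 n ⟨by have := hn.1; omega, hn.2⟩
      refine le_of_isTrappingDegeneration ha haM (r₁ := r₁ n) (r₂ := r₂ n) hχ hκ hc hadm ?_ ?_ ?_
      · intro p hp hV
        have hω2 : 0 < ω ^ 2 := by positivity
        have hV' : |V0 M a ω m Λ p - ω ^ 2| < b * ω ^ 2 :=
          hV.trans_lt (mul_lt_mul_of_pos_right (by linarith) hω2)
        have h6 := V0'_eq_zero_of_isLocalMax hp.2
        obtain ⟨h7, h8⟩ := hn' p hp.1 hV'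
        constructor
        · by_contra! h
          linarith [h7 h.le, hpos ω p hω hp.1]
        · by_contra! h
          linarith [(h8 h.le).1]
      · rcases hr with hr | hr
        · exact hr.1
        · linarith [mem_Ici.1 hr]
      · rcases hr with hr | hr
        · exact Or.inl hr.2
        · exact Or.inr hr
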